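/- Let $\Bbbk$ be a commutative ring with unit and let $X,Y,Z$ be simplicial sets. Write $C(X)$ for the normalized chain complex of $X$ with coefficients in $\Bbbk$; tensor products are over $\Bbbk$. For $p,q\ge 0$, a $(p,q)$-shuffle $(\alpha,\beta)\vdash(p,q)$ is a partition of $\{0,\dots,p+q-1\}$ into subsets $\alpha=\{\alpha_1<\dots<\alpha_p\}$ and $\beta=\{\beta_1<\dots<\beta_q\}$, and $(-1)^{(\alpha,\beta)}$ is the sign of the permutation $(\alpha_1,\dots,\alpha_p,\beta_1,\dots,\beta_q)$. For such an $\alpha$ put $s_\alpha=s_{\alpha_p}\cdots s_{\alpha_1}$ (iterated degeneracies, $s_\emptyset=1$), let $\alpha+m$ denote the set $\{a+m : a\in\alpha\}$, and put $\partial_i^j=\partial_i\partial_{i+1}\cdots\partial_j$ (iterated faces, $\partial_i^{i-1}=1$). The shuffle map $\nabla=\nabla_{X,Y}\colon C(X)\otimes C(Y)\to C(X\times Y)$ is given by $$\nabla(x\otimes y)=\sum_{(\alpha,\beta)\vdash(p,q)}(-1)^{(\alpha,\beta)}\,(s_\beta x,\,s_\alpha y)\qquad (x\in X_p,\ y\in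 Y_q),$$ and the Eilenberg–Mac Lane homotopy $H=H_{X,Y}\colon C(X\times Y)\to C(X\times Y)$, of degree $1$, is given for $(x,y)\in X_n\times Y_n$ by $$H(x,y)=\sum_{0\le p+q<n}\ \sum_{(\alpha,\beta)\vdash(p+1,q)}(-1)^{m+1+(\alpha,\beta)}\,\bigl(s_{\beta+m}\,s_{m-1}\,\partial_{n-q+1}^{n}x,\ s_{\alpha+m}\,\partial_{m}^{n-q-1}y\bigr),\qquad m=n-p-q,$$ where $p,q\ge0$. Identify $(X\times Y)\times Z=X\times(Y\times Z)$. Then $$H_{X\times Y,Z}\circ\nabla_{X,Y\times Z}=\nabla_{X,Y\times Z}\circ(1\otimes H_{Y,Z})\colon\ C(X)\otimes C(Y\times Z)\to C(X\times Y\times Z),\tag{B$_1$}$$ $$H_{X,Y\times Z}\circ\nabla_{X\times Y,Z}=\nabla_{X\times Y,Z}\circ(H_{X,Y}\otimes 1)\colon\ C(X\times Y)\otimes C(Z)\to C(X\times Y\times Z),\tag{B$_2$}$$ where, by the Koszul sign rule, $(1\otimes H_{Y,Z})(a\otimes b)=(-1)^{\deg a}\,a\otimes H_{Y,Z}(b)$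 and $(H_{X,Y}\otimes 1)(a\otimes b)=H_{X,Y}(a)\otimes b$. -/

import Mathlib

open CategoryTheory Limits MonoidalCategory Simplicial
open scoped TensorProduct

universe u v

noncomputable section

namespace EilenbergZilber

/-! ### Iterated faces and degeneracies -/

/-- The monotone surjection `[N] → [n]` that identifies `a` and `a + 1` for every `a ∈ α`.
It sends `j` to the number of elements of `{0, …, j - 1}` outside `α`.  This number is at most
`n` when `N = n + |α|` and `α ⊆ {0, …, N - 1}`, the only case that matters, so the minimum
with `n` then has no effect. -/
def degeneracyHom (α : Finset ℕ) (n N : ℕ) : ⦋N⦌ ⟶ ⦋n⦌ :=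
  SimplexCategory.mkHom
    { toFun := fun j => ⟨min (Finset.range j \ α).card n, by omega⟩
      monotone' := fun i j hij => by
        have : (Finset.range i \ α).card ≤ (Finset.range j \ α).card :=
          Finset.card_le_card
            (Finset.sdiff_subset_sdiff (Finset.range_mono (by exact_mod_cast hij)) le_rfl)
        simp only [Fin.mk_le_mk]
        omega }

/-- The injection `[n] → [N]` that omits `a, a + 1, …, a + c - 1`, where `N = n + c`
(again the minimum with `N` has no effect in that case). -/
def faceHom (a c n N : ℕ) : ⦋n⦌ ⟶ ⦋N⦌ :=
  SimplexCategory.mkHom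
    { toFun := fun j => ⟨min (if (j : ℕ) < a then (j : ℕ) else j + c) N, by omega⟩
      monotone' := fun i j hij => by
        have : (i : ℕ) ≤ j := by exact_mod_cast hij
        simp only [Fin.mk_le_mk]
        split_ifs <;> omega }

/-- The iterated degeneracy `s_α x = s_{α_p} ⋯ s_{α_1} x` for `α = {α_1 < ⋯ < α_p}`, of
dimension `N = n + p` if `x` has dimension `n`; see `degeneracies_empty` and
`degeneracies_insert`. -/
def degeneracies (X : SSet.{u}) (α : Finset ℕ) {n : ℕ} (N : ℕ) (x : X _⦋n⦌) : X _⦋N⦌ :=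
  X.map (degeneracyHom α n N).op x

/-- The iterated face `∂_a ∂_{a+1} ⋯ ∂_{a+c-1} x` (`c` faces), of dimension `n = N - c` if `x` has
dimension `N`; see `faces_zero` and `faces_succ`. -/
def faces (X : SSet.{u}) (a c : ℕ) {N : ℕ} (n : ℕ) (x : X _⦋N⦌) : X _⦋n⦌ :=
  X.map (faceHom a c n N).op x

lemma degeneracyHom_apply (α : Finset ℕ) (n N : ℕ) (j : Fin (N + 1)) :
    ((degeneracyHom α n N).toOrderHom j : ℕ) = min (Finset.range j \ α).card n := rfl

lemma faceHom_apply (a c n N : ℕ) (j : Fin (n + 1)) :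
    ((faceHom a c n N).toOrderHom j : ℕ) = min (if (j : ℕ) < a then (j : ℕ) else j + c) N := rfl

lemma map_map {X : SSet.{u}} {a b c : ℕ} (f : ⦋a⦌ ⟶ ⦋b⦌) (g : ⦋b⦌ ⟶ ⦋c⦌) (x : X _⦋c⦌) :
    X.map f.op (X.map g.op x) = X.map (f ≫ g).op x := by
  rw [op_comp, X.map_comp]; rfl

lemma hom_ext_val {a b : ℕ} {f g : ⦋a⦌ ⟶ ⦋b⦌}
    (h : ∀ j, (f.toOrderHom j : ℕ) = g.toOrderHom j) : f = g := by
  ext j; exact h j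

/-- `s_∅ x = x`. -/
lemma degeneracies_empty (X : SSet.{u}) {n : ℕ} (x : X _⦋n⦌) : degeneracies X ∅ n x = x := by
  have : degeneracyHom ∅ n n = 𝟙 _ := by
    apply hom_ext_val
    intro j
    have : (j : ℕ) < n + 1 := j.2
    rw [degeneracyHom_apply]
    simp
    omega
  rw [degeneracies, this, op_id, X.map_id]; rfl

/-- `s_{α ∪ {b}} x = s_b s_α x` if `b` is larger than all elements of `α`. -/
lemma degeneracies_insert (X : SSet.{u}) {n N : ℕ} (x : X _⦋n⦌) (α : Finset ℕ) (b : Fin (N + 1))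
    (hα : ∀ a ∈ α, a < (b : ℕ)) :
    degeneracies X (insert (b : ℕ) α) (N + 1) x = X.σ b (degeneracies X α N x) := by
  have : degeneracyHom (insert (b : ℕ) α) n (N + 1) =
      SimplexCategory.σ b ≫ degeneracyHom α n N := by
    apply hom_ext_val
    intro j
    have hj : (((SimplexCategory.σ b ≫ degeneracyHom α n N).toOrderHom j : Fin (n + 1)) : ℕ) =
      min (Finset.range ((Fin.predAbove b j : Fin (N + 1)) : ℕ) \ α).card n := rfl
    rw [hj, degeneracyHom_apply]
    congr 1
    by_cases h : (j : ℕ) ≤ b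
    · rw [Fin.predAbove_of_le_castSucc _ _ (by rw [Fin.le_def]; simpa using h)]
      congr 1
      ext i
      have hc (h' : j ≠ Fin.last (N + 1)) : (Fin.castPred j h' : ℕ) = j := rfl
      simp only [Finset.mem_sdiff, Finset.mem_range, Finset.mem_insert, hc]
      constructor
      · rintro ⟨h1, h2⟩
        exact ⟨h1, fun h3 => h2 (Or.inr h3)⟩
      · rintro ⟨h1, h2⟩
        refine ⟨h1, ?_⟩
        rintro (h3 | h3)
        · omega
        · exact h2 h3
    · rw [Fin.predAbove_of_castSucc_lt _ _ (by rw [Fin.lt_def]; simpa using h)]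
      have h1 : insert (b : ℕ) α ⊆ Finset.range j := by
        intro i hi
        rcases Finset.mem_insert.1 hi with rfl | hi
        · simpa using h
        · have := hα i hi
          simp; omega
      have h2 : α ⊆ Finset.range ((j : ℕ) - 1) := by
        intro i hi
        have := hα i hi
        simp; omega
      have h3 : (b : ℕ) ∉ α := fun hb => lt_irrefl _ (hα _ hb)
      rw [Finset.card_sdiff_of_subset h1, Finset.card_insert_of_notMem h3, Fin.val_pred,
        Finset.card_sdiff_of_subset h2, Finset.card_range, Finset.card_range]
      omega
  rw [degeneracies, this, ← map_map]; rfl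

/-- An empty iteration of face maps is the identity. -/
lemma faces_zero (X : SSet.{u}) (a : ℕ) {n : ℕ} (x : X _⦋n⦌) : faces X a 0 n x = x := by
  have : faceHom a 0 n n = 𝟙 _ := by
    apply hom_ext_val
    intro j
    have : (j : ℕ) < n + 1 := j.2
    rw [faceHom_apply]
    simp
    omega
  rw [faces, this, op_id, X.map_id]; rfl

/-- `∂_a ⋯ ∂_{a+c} x = ∂_a ⋯ ∂_{a+c-1} (∂_{a+c} x)`. -/
lemma faces_succ (X : SSet.{u}) (a c : ℕ) {n : ℕ} (hn : a ≤ n + 1) (x : X _⦋n + c + 1⦌) :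
    faces X a (c + 1) n x = faces X a c n (X.δ ⟨a + c, by omega⟩ x) := by
  have : faceHom a (c + 1) n (n + c + 1) =
      faceHom a c n (n + c) ≫ SimplexCategory.δ ⟨a + c, by omega⟩ := by
    apply hom_ext_val
    intro j
    have hjn : (j : ℕ) < n + 1 := j.2
    have hj : (((faceHom a c n (n + c) ≫ SimplexCategory.δ ⟨a + c, by omega⟩).toOrderHom j :
        Fin (n + c + 1 + 1)) : ℕ) =
      ((Fin.succAbove (⟨a + c, by omega⟩ : Fin (n + c + 2))
        ⟨min (if (j : ℕ) < a then (j : ℕ) else j + c) (n + c), by omega⟩ : Fin (n + c + 2)) : ℕ) :=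
      rfl
    rw [hj, faceHom_apply, Fin.succAbove]
    simp only [Fin.lt_def, Fin.val_castSucc]
    split_ifs <;> simp <;> omega
  rw [faces, this, ← map_map]; rfl

/-! ### Normalized chains -/

section Chains

variable (k : Type v) [CommRing k]

/-- The ring `k` as a module over itself, lifted to a universe where the normalized chain complexes
of all simplicial sets in `Type u` exist. -/
abbrev coeff : ModuleCat.{max u v} k := ModuleCat.of k (ULift.{u} k)

/-- The degree `n` part of the normalized chain complex of `X` with coefficients in `k`. -/
abbrev ChainsIn (X : SSet.{u}) (n : ℕ) : Type (max u v) :=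
  (X.normalizedChainComplex (coeff.{u} k)).X n

/-- The graded `k`-module `C(X)` underlying the normalized chain complex of `X`, as the direct sum
of its homogeneous parts. -/
abbrev Chains (X : SSet.{u}) : Type (max u v) :=
  DirectSum ℕ (fun n => ChainsIn.{u, v} k X n)

variable {X Y Z : SSet.{u}}

/-- The class of an `n`-simplex in the normalized chains of degree `n`. -/
def simplexIn {n : ℕ} (x : X _⦋n⦌) : ChainsIn k X n :=
  (X.ιNormalizedChainComplex (R := coeff.{u} k) x).hom ⟨1⟩

/-- The class of an `n`-simplex in `C(X)`. -/
def simplex {n : ℕ} (x : X _⦋n⦌) : Chains k X :=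
  DirectSum.lof k ℕ (fun n => ChainsIn k X n) n (simplexIn k x)

lemma simplexIn_eq_zero {n : ℕ} (x : X _⦋n⦌) (hx : x ∈ X.degenerate n) :
    simplexIn k x = 0 := by
  rw [simplexIn, SSet.ιNormalizedChainComplex_eq_zero X x hx]; rfl

lemma simplex_eq_zero {n : ℕ} (x : X _⦋n⦌) (hx : x ∈ X.degenerate n) : simplex k x = 0 := by
  rw [simplex, simplexIn_eq_zero k x hx, map_zero]

variable {k}
variable {M : Type (max u v)} [AddCommGroup M] [Module k M]

lemma chainsIn_hom_ext {n : ℕ} {f g : ChainsIn k X n →ₗ[k] M}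
    (h : ∀ x : X _⦋n⦌, f (simplexIn k x) = g (simplexIn k x)) : f = g := by
  have : ModuleCat.ofHom f = ModuleCat.ofHom g := by
    apply SSet.normalizedChainComplex_hom_ext
    intro x _
    ext c
    have hc : c = c.down • (⟨1⟩ : ULift.{u} k) := by
      ext; simp
    rw [hc, map_smul, map_smul]
    exact congrArg (c.down • ·) (h x)
  exact congrArg ModuleCat.Hom.hom this

/-- Two linear maps on `C(X)` agree if they agree on simplices. -/
lemma chains_hom_ext {f g : Chains k X →ₗ[k] M}
    (h : ∀ (n : ℕ) (x : X _⦋n⦌), f (simplex k x) = g (simplex k x)) : f = g :=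
  DirectSum.linearMap_ext k fun n => chainsIn_hom_ext fun x => h n x

lemma exists_liftIn {n : ℕ} (v : X _⦋n⦌ → M) (hv : ∀ x ∈ X.degenerate n, v x = 0) :
    ∃ f : ChainsIn k X n →ₗ[k] M, ∀ x, f (simplexIn k x) = v x := by
  let F : (X.normalizedChainComplex (coeff.{u} k)).X n ⟶ ModuleCat.of k M :=
    (X.isColimitCofanNormalizedChainComplex (coeff.{u} k) n).desc (Cofan.mk (ModuleCat.of k M)
      fun x => ModuleCat.ofHom
        ((LinearMap.toSpanSingleton k M (v x)).comp (ULift.moduleEquiv (R := k)).toLinearMap))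
  refine ⟨F.hom, fun x => ?_⟩
  by_cases hx : x ∈ X.degenerate n
  · rw [simplexIn_eq_zero k x hx, map_zero, hv x hx]
  · have h := (X.isColimitCofanNormalizedChainComplex (coeff.{u} k) n).fac
      (Cofan.mk (ModuleCat.of k M) fun x => ModuleCat.ofHom ((LinearMap.toSpanSingleton k M
        (v x)).comp (ULift.moduleEquiv (R := k)).toLinearMap)) ⟨⟨x, hx⟩⟩
    have h' := congrArg (fun φ => ModuleCat.Hom.hom φ (ULift.up (1 : k))) h
    refine h'.trans ?_
    change ((1 : k) • v x) = v x
    rw [one_smul]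

/-- The linear map on `C(X)` with prescribed values on simplices, which have to vanish on
degenerate ones; see `lift_simplex`. -/
def lift (v : ∀ n : ℕ, X _⦋n⦌ → M) (hv : ∀ n, ∀ x ∈ X.degenerate n, v n x = 0) :
    Chains k X →ₗ[k] M :=
  DirectSum.toModule k ℕ M fun n => (exists_liftIn (k := k) (v n) (hv n)).choose

@[simp]
lemma lift_simplex (v : ∀ n : ℕ, X _⦋n⦌ → M) (hv : ∀ n, ∀ x ∈ X.degenerate n, v n x = 0)
    {n : ℕ} (x : X _⦋n⦌) : lift (k := k) v hv (simplex k x) = v n x := by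
  rw [lift, simplex, DirectSum.toModule_lof]
  exact (exists_liftIn (k := k) (v n) (hv n)).choose_spec x

variable (k)

/-- The map `C(X) → C(Y)` induced by a morphism of simplicial sets. -/
def mapChains (f : X ⟶ Y) : Chains k X →ₗ[k] Chains k Y :=
  DirectSum.lmap fun n => ((SSet.normalizedChainComplexMap f (coeff.{u} k)).f n).hom

@[simp]
lemma mapChains_simplex (f : X ⟶ Y) {n : ℕ} (x : X _⦋n⦌) :
    mapChains k f (simplex k x) = simplex k (f.app _ x) := by
  have h : ((SSet.normalizedChainComplexMap f (coeff.{u} k)).f n).hom (simplexIn k x) =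
      simplexIn k (f.app _ x) := by
    unfold simplexIn
    rw [← LinearMap.comp_apply, ← ModuleCat.hom_comp, SSet.ι_normalizedChainComplexMap_f]
  rw [mapChains, simplex, DirectSum.lmap_lof, h, simplex]

/-- The degree involution `c ↦ (-1)^n c` for `c` of degree `n`. -/
def degreeSign (X : SSet.{u}) : Chains k X →ₗ[k] Chains k X :=
  DirectSum.lmap fun n => ((-1 : k) ^ n) • LinearMap.id

@[simp]
lemma degreeSign_simplex {n : ℕ} (x : X _⦋n⦌) :
    degreeSign k X (simplex k x) = (-1 : k) ^ n • simplex k x := by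
  rw [degreeSign, simplex, DirectSum.lmap_lof]
  exact map_smul _ _ _

variable {k}

/-- The tensor product of a map `f` of graded modules with a homogeneous map `g` of degree `d`,
with the Koszul sign: `(f ⊗ g)(a ⊗ b) = (-1)^{d |a|} f(a) ⊗ g(b)`. -/
def koszulTensor {X' Y' : SSet.{u}} (d : ℕ) (f : Chains k X →ₗ[k] Chains k X')
    (g : Chains k Y →ₗ[k] Chains k Y') :
    Chains k X ⊗[k] Chains k Y →ₗ[k] Chains k X' ⊗[k] Chains k Y' :=
  TensorProduct.map (f ∘ₗ (degreeSign k X ^ d)) g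

lemma koszulTensor_simplex {X' Y' : SSet.{u}} (d : ℕ) (f : Chains k X →ₗ[k] Chains k X')
    (g : Chains k Y →ₗ[k] Chains k Y') {n : ℕ} (x : X _⦋n⦌) (c : Chains k Y) :
    koszulTensor d f g (simplex k x ⊗ₜ c) = (-1 : k) ^ (d * n) • (f (simplex k x) ⊗ₜ[k] g c) := by
  have h : (degreeSign k X ^ d) (simplex k x) = (-1 : k) ^ (d * n) • simplex k x := by
    induction d with
    | zero => simp
    | succ d ih =>
      rw [pow_succ', Module.End.mul_apply, ih, map_smul, degreeSign_simplex, smul_smul, add_mul,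
        one_mul, pow_add]
  rw [koszulTensor, TensorProduct.map_tmul, LinearMap.comp_apply, h, map_smul,
    TensorProduct.smul_tmul']

end Chains

/-! ### The shuffle map and the homotopy -/

/-- The pair of two `n`-simplices, as a simplex of the product. -/
def pair {X Y : SSet.{u}} {n : ℕ} (x : X _⦋n⦌) (y : Y _⦋n⦌) : (X ⊗ Y : SSet.{u}) _⦋n⦌ := (x, y)

/-- The first components `α` of the `(p, q)`-shuffles `(α, β)`, that is, of the partitions of
`{0, …, p + q - 1}` into a subset `α` with `p` elements and a subset `β` with `q` elements. -/
def shuffles (p q : ℕ) : Finset (Finset ℕ) := (Finset.range (p + q)).powersetCard p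

/-- The second component `β` of the `(p, q)`-shuffle `(α, β)`. -/
def shuffleCompl (p q : ℕ) (α : Finset ℕ) : Finset ℕ := Finset.range (p + q) \ α

/-- The signature of the `(p, q)`-shuffle `(α, β)`: the sign of the permutation
`(α_1, …, α_p, β_1, …, β_q)` of `(0, …, p + q - 1)`, where `α` and `β` are listed in increasing
order.  The inversions of this permutation are the pairs `(a, b) ∈ α × β` with `b < a`. -/
def shuffleSign (p q : ℕ) (α : Finset ℕ) : ℤ :=
  (-1) ^ ((α ×ˢ shuffleCompl p q α).filter fun c => c.2 < c.1).card

/-- `shuffleSign` is the sign of the permutation that lists `α` and then `β`, both in increasing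
order. -/
lemma shuffleSign_eq_sign (p q : ℕ) (σ : Equiv.Perm (Fin (p + q)))
    (hα : StrictMono fun i : Fin p => σ (Fin.castAdd q i))
    (hβ : StrictMono fun i : Fin q => σ (Fin.natAdd p i)) :
    shuffleSign p q (Finset.univ.image fun i : Fin p => (σ (Fin.castAdd q i) : ℕ)) =
      (Equiv.Perm.sign σ : ℤ) := by
  have h1 : Equiv.Perm.sign σ = ∏ c : Fin p × Fin q,
      if σ (Fin.natAdd p c.2) < σ (Fin.castAdd q c.1) then (-1 : ℤˣ) else 1 := by
    have hin : ∀ j : Fin (p + q), ∏ i ∈ Finset.Iio j, (if σ i < σ j then (1 : ℤˣ) else -1) =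
        ∏ i, if i < j then (if σ i < σ j then (1 : ℤˣ) else -1) else 1 := by
      intro j
      rw [← Finset.prod_filter]
      congr 1
      ext i; simp
    rw [Equiv.Perm.sign_eq_prod_prod_Iio, Finset.prod_congr rfl fun j _ => hin j,
      Fin.prod_univ_add]
    rw [Finset.prod_eq_one, one_mul, Fintype.prod_prod_type_right]
    · refine Finset.prod_congr rfl fun b _ => ?_
      rw [Fin.prod_univ_add, mul_comm, Finset.prod_eq_one, one_mul]
      · refine Finset.prod_congr rfl fun a _ => ?_
        have hlt : Fin.castAdd q a < Fin.natAdd p b := by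
          simp only [Fin.lt_def, Fin.val_castAdd, Fin.val_natAdd]; omega
        have hne : σ (Fin.castAdd q a) ≠ σ (Fin.natAdd p b) := fun h => hlt.ne (σ.injective h)
        rw [if_pos hlt]
        rcases lt_or_gt_of_ne hne with h | h
        · rw [if_pos h, if_neg h.not_gt]
        · rw [if_pos h, if_neg h.not_gt]
      · intro b' _
        split_ifs with h2 h3
        · rfl
        · refine absurd (hβ (a := b') (b := b) ?_) h3
          simp only [Fin.lt_def, Fin.val_natAdd] at h2 ⊢
          omega
        · rfl
    · intro a _
      rw [Fin.prod_univ_add, Finset.prod_eq_one, one_mul, Finset.prod_eq_one]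
      · intro b _
        rw [if_neg]
        simp only [Fin.lt_def, Fin.val_castAdd, Fin.val_natAdd]; omega
      · intro a' _
        split_ifs with h2 h3
        · rfl
        · exact absurd (hα (a := a') (b := a) h2) h3
        · rfl
  have h2 : (Finset.range (p + q) \
      Finset.univ.image fun i : Fin p => (σ (Fin.castAdd q i) : ℕ)) =
      Finset.univ.image fun i : Fin q => (σ (Fin.natAdd p i) : ℕ) := by
    ext c
    simp only [Finset.mem_sdiff, Finset.mem_range, Finset.mem_image, Finset.mem_univ, true_and]
    constructor
    · rintro ⟨hc, hn⟩
      obtain ⟨d, hd⟩ := σ.surjective ⟨c, hc⟩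
      induction d using Fin.addCases with
      | left i => exact absurd ⟨i, by rw [hd]⟩ hn
      | right i => exact ⟨i, by rw [hd]⟩
    · rintro ⟨i, rfl⟩
      refine ⟨(σ (Fin.natAdd p i)).2, ?_⟩
      rintro ⟨i', hi'⟩
      have := congrArg Fin.val (σ.injective (Fin.ext hi'))
      simp only [Fin.val_castAdd, Fin.val_natAdd] at this
      omega
  rw [h1, Finset.prod_ite, Finset.prod_const_one, mul_one, Finset.prod_const, shuffleSign,
    shuffleCompl, h2]
  push_cast
  congr 1
  symm
  refine Finset.card_bij (fun c _ => ((σ (Fin.castAdd q c.1) : ℕ), (σ (Fin.natAdd p c.2) : ℕ)))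
    ?_ ?_ ?_
  · intro c hc
    simp only [Finset.mem_filter, Finset.mem_univ, true_and, Fin.lt_def] at hc
    simp [hc]
  · rintro ⟨a, b⟩ _ ⟨a', b'⟩ _ h
    simp only [Prod.mk.injEq] at h
    exact Prod.ext (hα.injective (Fin.ext h.1)) (hβ.injective (Fin.ext h.2))
  · rintro ⟨a, b⟩ h
    simp only [Finset.mem_filter, Finset.mem_product, Finset.mem_image, Finset.mem_univ,
      true_and] at h
    obtain ⟨⟨⟨a', rfl⟩, ⟨b', rfl⟩⟩, h⟩ := h
    exact ⟨(a', b'), by simpa using h, rfl⟩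

section Degenerate

variable {X Y : SSet.{u}}

lemma pair_degenerate {a b N : ℕ} (f : ⦋N⦌ ⟶ ⦋a⦌) (g : ⦋N⦌ ⟶ ⦋b⦌) (x : X _⦋a⦌) (y : Y _⦋b⦌)
    (i : ℕ) (hi : i < N)
    (hf : (f.toOrderHom (⟨i, by omega⟩ : Fin (N + 1)) : ℕ) = f.toOrderHom (⟨i + 1, by omega⟩ : Fin (N + 1)))
    (hg : (g.toOrderHom (⟨i, by omega⟩ : Fin (N + 1)) : ℕ) = g.toOrderHom (⟨i + 1, by omega⟩ : Fin (N + 1))) :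
    pair (X.map f.op x) (Y.map g.op y) ∈ (X ⊗ Y : SSet.{u}).degenerate N := by
  obtain ⟨N, rfl⟩ : ∃ M, N = M + 1 := ⟨N - 1, by omega⟩
  have key : ∀ {c : ℕ} (h : ⦋N + 1⦌ ⟶ ⦋c⦌),
      (h.toOrderHom (⟨i, by omega⟩ : Fin (N + 1 + 1)) : ℕ) = h.toOrderHom (⟨i + 1, by omega⟩ : Fin (N + 1 + 1)) →
      h = SimplexCategory.σ (⟨i, hi⟩ : Fin (N + 1)) ≫
        SimplexCategory.δ (⟨i + 1, by omega⟩ : Fin (N + 2)) ≫ h := by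
    intro c h hh
    apply hom_ext_val
    intro (j : Fin (N + 1 + 1))
    change _ = ((h.toOrderHom (Fin.succAbove (⟨i + 1, by omega⟩ : Fin (N + 2))
      (Fin.predAbove (⟨i, hi⟩ : Fin (N + 1)) j)) : Fin (c + 1)) : ℕ)
    have hv : (Fin.succAbove (⟨i + 1, by omega⟩ : Fin (N + 2))
        (Fin.predAbove (⟨i, hi⟩ : Fin (N + 1)) j) : ℕ) = if (j : ℕ) = i + 1 then i else j := by
      rcases Nat.lt_or_ge i j with h' | h'
      · rw [Fin.predAbove_of_castSucc_lt _ _ (by rw [Fin.lt_def]; exact h'), Fin.succAbove]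
        simp only [Fin.lt_def, Fin.val_castSucc, Fin.val_pred]
        split_ifs <;> simp <;> omega
      · rw [Fin.predAbove_of_le_castSucc _ _ (by rw [Fin.le_def]; exact h'), Fin.succAbove]
        simp only [Fin.lt_def, Fin.castSucc_castPred]
        split_ifs <;> (try simp) <;> omega
    by_cases hj : (j : ℕ) = i + 1
    · rw [if_pos hj] at hv
      have h2 : j = (⟨i + 1, by omega⟩ : Fin (N + 1 + 1)) := Fin.ext hj
      have h1 : Fin.succAbove (⟨i + 1, by omega⟩ : Fin (N + 2))
        (Fin.predAbove (⟨i, hi⟩ : Fin (N + 1)) j) = ⟨i, by omega⟩ := Fin.ext hv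
      rw [h1, hh, h2]
    · rw [if_neg hj] at hv
      rw [Fin.ext hv]
  refine ⟨N, by omega, SimplexCategory.σ (⟨i, hi⟩ : Fin (N + 1)),
    pair (X.map (SimplexCategory.δ (⟨i + 1, by omega⟩ : Fin (N + 2)) ≫ f).op x)
      (Y.map (SimplexCategory.δ (⟨i + 1, by omega⟩ : Fin (N + 2)) ≫ g).op y), ?_⟩
  change pair (X.map _ (X.map _ x)) (Y.map _ (Y.map _ y)) = _
  rw [map_map, map_map, ← key f hf, ← key g hg]

lemma exists_σ_of_degenerate {n : ℕ} (x : X _⦋n⦌) (hx : x ∈ X.degenerate n) :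
    ∃ (m : ℕ) (f : ⦋n⦌ ⟶ ⦋m⦌) (x' : X _⦋m⦌) (i : ℕ) (hi : i < n), x = X.map f.op x' ∧
      (f.toOrderHom (⟨i, by omega⟩ : Fin (n + 1)) : ℕ) = f.toOrderHom (⟨i + 1, by omega⟩ : Fin (n + 1)) := by
  obtain ⟨n, rfl⟩ : ∃ m, n = m + 1 := by
    rcases n with _ | n
    · simp at hx
    · exact ⟨n, rfl⟩
  rw [SSet.degenerate_eq_iUnion_range_σ] at hx
  obtain ⟨i, x', rfl⟩ := Set.mem_iUnion.1 hx
  refine ⟨n, SimplexCategory.σ i, x', i, i.2, rfl, ?_⟩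
  change ((Fin.predAbove i ⟨i, by omega⟩ : Fin (n + 1)) : ℕ) = (Fin.predAbove i ⟨i + 1, by omega⟩ :
    Fin (n + 1))
  rw [Fin.predAbove_of_castSucc_lt i ⟨i + 1, by omega⟩ (by rw [Fin.lt_def]; simp),
    Fin.predAbove_of_le_castSucc i ⟨i, by omega⟩ (by rw [Fin.le_def]; simp)]
  simp

lemma exists_step (S : Finset ℕ) (N i : ℕ) (h : i < (Finset.range N \ S).card) :
    ∃ j < N, j ∉ S ∧ (Finset.range j \ S).card = i := by
  induction N with
  | zero => simp at h
  | succ N ih =>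
    by_cases h1 : i < (Finset.range N \ S).card
    · obtain ⟨j, hj, hj'⟩ := ih h1
      exact ⟨j, by omega, hj'⟩
    · by_cases hN : N ∈ S
      · rw [Finset.range_add_one, Finset.insert_sdiff_of_mem _ hN] at h
        exact absurd h h1
      · refine ⟨N, by omega, hN, ?_⟩
        rw [Finset.range_add_one, Finset.insert_sdiff_of_notMem _ hN,
          Finset.card_insert_of_notMem (by simp)] at h
        omega

lemma card_range_succ_sdiff_of_mem (S : Finset ℕ) (j : ℕ) (hj : j ∈ S) :
    (Finset.range (j + 1) \ S).card = (Finset.range j \ S).card := by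
  rw [Finset.range_add_one, Finset.insert_sdiff_of_mem _ hj]

lemma card_range_succ_sdiff_of_notMem (S : Finset ℕ) (j : ℕ) (hj : j ∉ S) :
    (Finset.range (j + 1) \ S).card = (Finset.range j \ S).card + 1 := by
  rw [Finset.range_add_one, Finset.insert_sdiff_of_notMem _ hj,
    Finset.card_insert_of_notMem (by simp)]

lemma card_range_sdiff_shift (S : Finset ℕ) (m j : ℕ) :
    (Finset.range (m + j) \ S.image (· + m)).card = m + (Finset.range j \ S).card := by
  induction j with
  | zero =>
    rw [Finset.sdiff_eq_self_of_disjoint]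
    · simp
    · rw [Finset.disjoint_left]
      intro a ha hb
      obtain ⟨c, _, rfl⟩ := Finset.mem_image.1 hb
      simp at ha
  | succ j ih =>
    have hmem : m + j ∈ S.image (· + m) ↔ j ∈ S := by
      simp [add_comm m]
    by_cases hj : j ∈ S
    · rw [← add_assoc, card_range_succ_sdiff_of_mem _ _ (hmem.2 hj), ih,
        card_range_succ_sdiff_of_mem _ _ hj]
    · rw [← add_assoc, card_range_succ_sdiff_of_notMem _ _ (fun h => hj (hmem.1 h)), ih,
        card_range_succ_sdiff_of_notMem _ _ hj, add_assoc]

lemma card_range_sdiff_shift_of_le (S : Finset ℕ) (m j : ℕ) (hj : j ≤ m) :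
    (Finset.range j \ S.image (· + m)).card = j := by
  rw [Finset.sdiff_eq_self_of_disjoint]
  · simp
  · rw [Finset.disjoint_left]
    intro a ha hb
    obtain ⟨c, _, rfl⟩ := Finset.mem_image.1 hb
    simp at ha
    omega

lemma card_shuffleCompl {p q : ℕ} {α : Finset ℕ} (hα : α ∈ shuffles p q) :
    (Finset.range (p + q) \ α).card = q ∧
      (Finset.range (p + q) \ shuffleCompl p q α).card = p := by
  obtain ⟨h1, h2⟩ := Finset.mem_powersetCard.1 hα
  constructor
  · rw [Finset.card_sdiff_of_subset h1, Finset.card_range]; omega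
  · rw [shuffleCompl, Finset.sdiff_sdiff_eq_self h1, h2]

end Degenerate

section Maps

variable (k : Type v) [CommRing k] (X Y : SSet.{u})

variable {X Y} in
/-- The value of the shuffle map on `x ⊗ y`: the sum of `(-1)^{(α,β)} (s_β x, s_α y)` over all
`(p, q)`-shuffles `(α, β)`. -/
def shuffleValue {p q : ℕ} (x : X _⦋p⦌) (y : Y _⦋q⦌) : Chains k (X ⊗ Y : SSet.{u}) :=
  ∑ α ∈ shuffles p q, shuffleSign p q α •
    simplex k (pair (degeneracies X (shuffleCompl p q α) (p + q) x) (degeneracies Y α (p + q) y))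

variable {X Y} in
/-- The value of the homotopy `H` on an `n`-simplex `(x, y)` of `X × Y`: the sum over all
`p, q ≥ 0` with `p + q < n` and all `(p + 1, q)`-shuffles `(α, β)` of
`(-1)^{m + 1 + (α,β)} (s_{β+m} s_{m-1} ∂_{n-q+1} ⋯ ∂_n x, s_{α+m} ∂_m ⋯ ∂_{n-q-1} y)`
where `m = n - p - q`. -/
def homotopyValue {n : ℕ} (x : X _⦋n⦌) (y : Y _⦋n⦌) : Chains k (X ⊗ Y : SSet.{u}) :=
  ∑ p ∈ Finset.range n, ∑ q ∈ Finset.range (n - p), ∑ α ∈ shuffles (p + 1) q,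
    let m := n - p - q
    ((-1) ^ (m + 1) * shuffleSign (p + 1) q α) •
      simplex k (pair
        (degeneracies X ((shuffleCompl (p + 1) q α).image (· + m)) (n + 1)
          (degeneracies X {m - 1} (n - q + 1) (faces X (n - q + 1) q (n - q) x)))
        (degeneracies Y (α.image (· + m)) (n + 1) (faces Y m p (n - p) y)))

variable {X Y} in
lemma shuffleValue_degenerate_left {p q : ℕ} (x : X _⦋p⦌) (hx : x ∈ X.degenerate p) (y : Y _⦋q⦌) :
    shuffleValue k x y = 0 := by
  obtain ⟨m, f, x', i, hi, rfl, hf⟩ := exists_σ_of_degenerate x hx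
  refine Finset.sum_eq_zero fun α hα => ?_
  obtain ⟨h1, h2⟩ := card_shuffleCompl hα
  obtain ⟨j, hj, hjS, hji⟩ := exists_step (shuffleCompl p q α) (p + q) i (by omega)
  have hjα : j ∈ α := by
    simpa [shuffleCompl, hj] using hjS
  rw [simplex_eq_zero, smul_zero]
  rw [degeneracies, map_map]
  refine pair_degenerate _ _ _ _ j hj ?_ ?_
  · have e1 : (degeneracyHom (shuffleCompl p q α) p (p + q)).toOrderHom
        (⟨j, by omega⟩ : Fin (p + q + 1)) = (⟨i, by omega⟩ : Fin (p + 1)) := by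
      apply Fin.ext
      rw [degeneracyHom_apply]
      simp only [hji]; omega
    have e2 : (degeneracyHom (shuffleCompl p q α) p (p + q)).toOrderHom
        (⟨j + 1, by omega⟩ : Fin (p + q + 1)) = (⟨i + 1, by omega⟩ : Fin (p + 1)) := by
      apply Fin.ext
      rw [degeneracyHom_apply]
      simp only [card_range_succ_sdiff_of_notMem _ _ hjS, hji]; omega
    change (f.toOrderHom _ : ℕ) = f.toOrderHom _
    rw [e1, e2, hf]
  · rw [degeneracyHom_apply, degeneracyHom_apply]
    simp only [card_range_succ_sdiff_of_mem _ _ hjα]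

variable {X Y} in
lemma shuffleValue_degenerate_right {p q : ℕ} (x : X _⦋p⦌) (y : Y _⦋q⦌)
    (hy : y ∈ Y.degenerate q) : shuffleValue k x y = 0 := by
  obtain ⟨m, f, y', i, hi, rfl, hf⟩ := exists_σ_of_degenerate y hy
  refine Finset.sum_eq_zero fun α hα => ?_
  obtain ⟨h1, h2⟩ := card_shuffleCompl hα
  obtain ⟨j, hj, hjS, hji⟩ := exists_step α (p + q) i (by omega)
  have hjβ : j ∈ shuffleCompl p q α := by
    simpa [shuffleCompl, hj] using hjS
  rw [simplex_eq_zero, smul_zero]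
  rw [degeneracies, degeneracies, map_map]
  refine pair_degenerate _ _ _ _ j hj ?_ ?_
  · rw [degeneracyHom_apply, degeneracyHom_apply]
    simp only [card_range_succ_sdiff_of_mem _ _ hjβ]
  · have e1 : (degeneracyHom α q (p + q)).toOrderHom
        (⟨j, by omega⟩ : Fin (p + q + 1)) = (⟨i, by omega⟩ : Fin (q + 1)) := by
      apply Fin.ext
      rw [degeneracyHom_apply]
      simp only [hji]; omega
    have e2 : (degeneracyHom α q (p + q)).toOrderHom
        (⟨j + 1, by omega⟩ : Fin (p + q + 1)) = (⟨i + 1, by omega⟩ : Fin (q + 1)) := by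
      apply Fin.ext
      rw [degeneracyHom_apply]
      simp only [card_range_succ_sdiff_of_notMem _ _ hjS, hji]; omega
    change (f.toOrderHom _ : ℕ) = f.toOrderHom _
    rw [e1, e2, hf]

variable {X Y} in
lemma homotopyValue_degenerate {n : ℕ} (w : (X ⊗ Y : SSet.{u}) _⦋n⦌)
    (hw : w ∈ (X ⊗ Y : SSet.{u}).degenerate n) : homotopyValue k w.1 w.2 = 0 := by
  obtain ⟨l, f, w', i, hi, rfl, hf⟩ := exists_σ_of_degenerate w hw
  change homotopyValue k (X.map f.op w'.1) (Y.map f.op w'.2) = 0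
  refine Finset.sum_eq_zero fun p hp => Finset.sum_eq_zero fun q hq =>
    Finset.sum_eq_zero fun α hα => ?_
  rw [Finset.mem_range] at hp hq
  obtain ⟨h1, h2⟩ := card_shuffleCompl hα
  obtain ⟨m, hm⟩ : ∃ m, m = n - p - q := ⟨_, rfl⟩
  simp only [← hm]
  rw [simplex_eq_zero, smul_zero]
  simp only [degeneracies, faces, map_map]
  -- the two vertex maps of the simplex, on the vertex in position `j`
  have hX : ∀ j (hj : j < n + 2), (((degeneracyHom ((shuffleCompl (p + 1) q α).image (· + m))
      (n - q + 1) (n + 1) ≫ degeneracyHom {m - 1} (n - q) (n - q + 1) ≫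
      faceHom (n - q + 1) q (n - q) n).toOrderHom (⟨j, hj⟩ : Fin (n + 1 + 1)) : Fin (n + 1)) : ℕ) =
      min (if min (Finset.range (min (Finset.range j \
        (shuffleCompl (p + 1) q α).image (· + m)).card (n - q + 1)) \ {m - 1}).card (n - q) <
          n - q + 1 then min (Finset.range (min (Finset.range j \
        (shuffleCompl (p + 1) q α).image (· + m)).card (n - q + 1)) \ {m - 1}).card (n - q) else
        min (Finset.range (min (Finset.range j \
        (shuffleCompl (p + 1) q α).image (· + m)).card (n - q + 1)) \ {m - 1}).card (n - q) + q)
        n := fun j hj => rfl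
  have hY : ∀ j (hj : j < n + 2), (((degeneracyHom (α.image (· + m)) (n - p) (n + 1) ≫
      faceHom m p (n - p) n).toOrderHom (⟨j, hj⟩ : Fin (n + 1 + 1)) : Fin (n + 1)) : ℕ) =
      min (if min (Finset.range j \ α.image (· + m)).card (n - p) < m then
        min (Finset.range j \ α.image (· + m)).card (n - p) else
        min (Finset.range j \ α.image (· + m)).card (n - p) + p) n := fun j hj => rfl
  have hs : ∀ j, (Finset.range j \ {m - 1}).card = if j ≤ m - 1 then j else j - 1 := by
    intro j
    split_ifs with h
    · rw [Finset.sdiff_singleton_eq_erase, Finset.erase_eq_of_notMem (by simpa using h),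
        Finset.card_range]
    · rw [Finset.sdiff_singleton_eq_erase, Finset.card_erase_of_mem (by simpa using h),
        Finset.card_range]
  simp only [hs] at hX
  set gX := degeneracyHom ((shuffleCompl (p + 1) q α).image (· + m))
      (n - q + 1) (n + 1) ≫ degeneracyHom {m - 1} (n - q) (n - q + 1) ≫
      faceHom (n - q + 1) q (n - q) n with hgX
  set gY := degeneracyHom (α.image (· + m)) (n - p) (n + 1) ≫ faceHom m p (n - p) n with hgY
  -- it suffices that in some step either nothing happens or the step from `i` to `i + 1` is made
  have hcomp : ∀ (g : ⦋n + 1⦌ ⟶ ⦋n⦌) (j : ℕ) (hj : j < n + 1),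
      ((g.toOrderHom (⟨j, by omega⟩ : Fin (n + 1 + 1)) : Fin (n + 1)) : ℕ) =
        (g.toOrderHom (⟨j + 1, by omega⟩ : Fin (n + 1 + 1)) : Fin (n + 1)) ∨
      (((g.toOrderHom (⟨j, by omega⟩ : Fin (n + 1 + 1)) : Fin (n + 1)) : ℕ) = i ∧
        ((g.toOrderHom (⟨j + 1, by omega⟩ : Fin (n + 1 + 1)) : Fin (n + 1)) : ℕ) = i + 1) →
      ((g ≫ f).toOrderHom (⟨j, by omega⟩ : Fin (n + 1 + 1)) : ℕ) =
        (g ≫ f).toOrderHom (⟨j + 1, by omega⟩ : Fin (n + 1 + 1)) := by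
    intro g j hj h
    change (f.toOrderHom (g.toOrderHom _) : ℕ) = f.toOrderHom (g.toOrderHom _)
    rcases h with h | ⟨ha, hb⟩
    · rw [Fin.ext h]
    · have ha' : g.toOrderHom (⟨j, by omega⟩ : Fin (n + 1 + 1)) = (⟨i, by omega⟩ : Fin (n + 1)) :=
        Fin.ext ha
      have hb' : g.toOrderHom (⟨j + 1, by omega⟩ : Fin (n + 1 + 1)) =
        (⟨i + 1, by omega⟩ : Fin (n + 1)) := Fin.ext hb
      rw [ha', hb', hf]
  have hfin : ∀ (j : ℕ) (hj : j < n + 1),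
      (((gX.toOrderHom (⟨j, by omega⟩ : Fin (n + 1 + 1)) : Fin (n + 1)) : ℕ) =
        (gX.toOrderHom (⟨j + 1, by omega⟩ : Fin (n + 1 + 1)) : Fin (n + 1)) ∨
      (((gX.toOrderHom (⟨j, by omega⟩ : Fin (n + 1 + 1)) : Fin (n + 1)) : ℕ) = i ∧
        ((gX.toOrderHom (⟨j + 1, by omega⟩ : Fin (n + 1 + 1)) : Fin (n + 1)) : ℕ) = i + 1)) →
      (((gY.toOrderHom (⟨j, by omega⟩ : Fin (n + 1 + 1)) : Fin (n + 1)) : ℕ) =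
        (gY.toOrderHom (⟨j + 1, by omega⟩ : Fin (n + 1 + 1)) : Fin (n + 1)) ∨
      (((gY.toOrderHom (⟨j, by omega⟩ : Fin (n + 1 + 1)) : Fin (n + 1)) : ℕ) = i ∧
        ((gY.toOrderHom (⟨j + 1, by omega⟩ : Fin (n + 1 + 1)) : Fin (n + 1)) : ℕ) = i + 1)) →
      pair (X.map (gX ≫ f).op w'.1) (Y.map (gY ≫ f).op w'.2) ∈
        (X ⊗ Y : SSet.{u}).degenerate (n + 1) := fun j hj hx hy =>
    pair_degenerate _ _ _ _ j hj (hcomp gX j hj hx) (hcomp gY j hj hy)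
  rw [hgX, hgY] at hfin
  simp only [Category.assoc] at hfin ⊢
  rw [← hgX, ← hgY] at hfin
  rcases Nat.lt_or_ge (i + 1) m with hi1 | hi1
  · refine hfin i (by omega) (Or.inr ?_) (Or.inr ?_)
    · rw [hX, hX, card_range_sdiff_shift_of_le _ _ _ (by omega),
        card_range_sdiff_shift_of_le _ _ _ (by omega)]
      constructor <;> split_ifs <;> omega
    · rw [hY, hY, card_range_sdiff_shift_of_le _ _ _ (by omega),
        card_range_sdiff_shift_of_le _ _ _ (by omega)]
      constructor <;> split_ifs <;> omega
  · rcases Nat.lt_or_ge i (n - q) with hi2 | hi2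
    · obtain ⟨j, hj, hjS, hji⟩ := exists_step (shuffleCompl (p + 1) q α) (p + 1 + q)
        (i + 1 - m) (by omega)
      have hjα : j ∈ α := by
        simpa [shuffleCompl, hj] using hjS
      refine hfin (m + j) (by omega) (Or.inr ?_) (Or.inl ?_)
      · rw [hX, hX, card_range_sdiff_shift, add_assoc, card_range_sdiff_shift,
          card_range_succ_sdiff_of_notMem _ _ hjS, hji]
        constructor <;> split_ifs <;> omega
      · rw [hY, hY, card_range_sdiff_shift, add_assoc, card_range_sdiff_shift,
          card_range_succ_sdiff_of_mem _ _ hjα]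
    · obtain ⟨j, hj, hjS, hji⟩ := exists_step α (p + 1 + q) (i - (n - q)) (by omega)
      have hjβ : j ∈ shuffleCompl (p + 1) q α := by
        simpa [shuffleCompl, hj] using hjS
      refine hfin (m + j) (by omega) (Or.inl ?_) (Or.inr ?_)
      · rw [hX, hX, card_range_sdiff_shift, add_assoc, card_range_sdiff_shift,
          card_range_succ_sdiff_of_mem _ _ hjβ]
      · rw [hY, hY, card_range_sdiff_shift, add_assoc, card_range_sdiff_shift,
          card_range_succ_sdiff_of_notMem _ _ hjS, hji]
        constructor <;> split_ifs <;> omega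

/-- The shuffle map `C(X) ⊗ C(Y) → C(X × Y)`. -/
def shuffle : Chains k X ⊗[k] Chains k Y →ₗ[k] Chains k (X ⊗ Y : SSet.{u}) :=
  TensorProduct.lift <| lift
    (fun p x => lift (fun q y => shuffleValue k x y)
      fun _ y hy => shuffleValue_degenerate_right k x y hy)
    fun _ x hx => chains_hom_ext fun _ y => by
      rw [lift_simplex, shuffleValue_degenerate_left k x hx, LinearMap.zero_apply]

/-- The Eilenberg–Mac Lane homotopy `H : C(X × Y) → C(X × Y)`, of degree `1`. -/
def homotopy : Chains k (X ⊗ Y : SSet.{u}) →ₗ[k] Chains k (X ⊗ Y : SSet.{u}) :=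
  lift (fun _ w => homotopyValue k w.1 w.2) fun _ w hw => homotopyValue_degenerate k w hw

variable {X Y}

@[simp]
lemma shuffle_simplex {p q : ℕ} (x : X _⦋p⦌) (y : Y _⦋q⦌) :
    shuffle k X Y (simplex k x ⊗ₜ simplex k y) = shuffleValue k x y := by
  rw [shuffle, TensorProduct.lift.tmul, lift_simplex, lift_simplex]

@[simp]
lemma homotopy_simplex {n : ℕ} (x : X _⦋n⦌) (y : Y _⦋n⦌) :
    homotopy k X Y (simplex k (pair x y)) = homotopyValue k x y := by
  rw [homotopy, lift_simplex]; rfl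

end Maps

end EilenbergZilber

end

/-! A simplex of a product is treated as a lattice path: a word of steps in ℕ³ whose coordinates
record how far a vertex advances in `X`, `Y` and `Z`. Basis simplices of the two tensor factors
become constant words, with steps (1,0,0) and (0,1,1) for the first identity, (1,1,0) and (0,0,1)
for the second. A word with a zero step repeats a vertex, so it is degenerate and vanishes in
normalized chains (`IsWordFamily.degenerate`).

In this language ∇ is the signed shuffle of words (`shuffleValue_eq_listShuffle`). The homotopy H
cuts a word as `u ++ s ++ t` and returns, with sign (-1)^|u|, the word `u`, then the single step `π₂
s.sum`, then all signed shuffles of `π₁ s` with `π₂ t` (`homotopyValue_eq_listHomotopy`). Here π₁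
and π₂ are the projections to the two factors of the product on which H acts.

For the first identity, apply H to a shuffle of `l₁` and `l₂`, where π₁ fixes the steps of `l₁` and
π₂ kills them. Cutting a shuffle amounts to cutting both words (`listShuffle_cut_self`). If part of
`l₁` falls into `t`, then π₂ produces a zero step and the term vanishes. So `l₁` is cut into two
pieces only, one shuffled into `u` and one into `s`; the latter does not change `π₂ s.sum`, and by
associativity of shuffles (`listShuffle_assoc`) it can be shuffled in last. Shuffling `l₁` into the
words of H(`l₂`) gives the same sum when the shuffles are split at the inserted step
(`listShuffle_append_cons_right`). This is `listHomotopy_shuffle_left`; the Koszul sign (-1)^|`l₁`|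
comes from moving `l₁` past the inserted step.

The second identity is dual (`listHomotopy_shuffle_right`): now π₁ kills `l₂`, so no part of `l₂`
may fall into `s`. The step is inserted into the other word, and no sign remains. -/

noncomputable section

namespace EilenbergZilber

/-! ### Signed shuffles and cuts of lists -/

section Lists

variable {A M N : Type*} [AddCommGroup M] [AddCommGroup N]

/-- The sum of `F w`, with the sign of the shuffle, over all shuffles `w` of two lists. -/
def listShuffle (l₁ l₂ : List A) (F : List A → M) : M :=
  match l₁, l₂ with
  | [], l₂ => F l₂
  | a :: l₁, [] => F (a :: l₁)
  | a :: l₁, b :: l₂ => listShuffle l₁ (b :: l₂) (fun w => F (a :: w)) +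
      (-1 : ℤ) ^ (l₁.length + 1) • listShuffle (a :: l₁) l₂ (fun w => F (b :: w))
termination_by l₁.length + l₂.length

/-- The sum of `G u v` over all decompositions `l = u ++ v`. -/
def cut (l : List A) (G : List A → List A → M) : M :=
  match l with
  | [] => G [] []
  | a :: l => G [] (a :: l) + cut l fun u v => G (a :: u) v

@[simp] lemma listShuffle_nil_left (l : List A) (F : List A → M) : listShuffle [] l F = F l := by
  rw [listShuffle]

@[simp] lemma listShuffle_nil_right (l : List A) (F : List A → M) : listShuffle l [] F = F l := by
  cases l <;> rw [listShuffle]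

lemma listShuffle_cons_cons (a b : A) (l₁ l₂ : List A) (F : List A → M) :
    listShuffle (a :: l₁) (b :: l₂) F = listShuffle l₁ (b :: l₂) (fun w => F (a :: w)) +
      (-1 : ℤ) ^ (l₁.length + 1) • listShuffle (a :: l₁) l₂ (fun w => F (b :: w)) := by
  rw [listShuffle]

@[simp] lemma cut_nil (G : List A → List A → M) : cut [] G = G [] [] := rfl

lemma cut_cons (a : A) (l : List A) (G : List A → List A → M) :
    cut (a :: l) G = G [] (a :: l) + cut l fun u v => G (a :: u) v := rfl

/-- Being a permutation of `l₁ ++ l₂` is all that is needed of a shuffle later on: it carries over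
length, membership and sum. -/
lemma listShuffle_congr {l₁ l₂ : List A} {F G : List A → M}
    (h : ∀ w, w.Perm (l₁ ++ l₂) → F w = G w) : listShuffle l₁ l₂ F = listShuffle l₁ l₂ G := by
  induction l₁ generalizing l₂ F G with
  | nil => simpa using h l₂ (List.Perm.refl _)
  | cons a l₁ ih₁ =>
    induction l₂ generalizing F G with
    | nil => simpa using h (a :: l₁) (by simp)
    | cons b l₂ ih₂ =>
      rw [listShuffle_cons_cons, listShuffle_cons_cons,
        ih₁ fun w hw => h (a :: w) (hw.cons a),
        ih₂ fun w hw => h (b :: w) ((hw.cons b).trans List.perm_middle.symm)]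

lemma cut_congr {l : List A} {F G : List A → List A → M}
    (h : ∀ u v, u ++ v = l → F u v = G u v) : cut l F = cut l G := by
  induction l generalizing F G with
  | nil => exact h [] [] rfl
  | cons a l ih =>
    rw [cut_cons, cut_cons, h [] (a :: l) rfl,
      ih fun u v huv => h (a :: u) v (by rw [List.cons_append, huv])]

/-! ### Linearity and interchange rules for shuffles and cuts -/

lemma map_listShuffle (f : M →+ N) (l₁ l₂ : List A) (F : List A → M) :
    f (listShuffle l₁ l₂ F) = listShuffle l₁ l₂ fun w => f (F w) := by
  induction l₁ generalizing l₂ F with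
  | nil => simp
  | cons a l₁ ih₁ =>
    induction l₂ generalizing F with
    | nil => simp
    | cons b l₂ ih₂ =>
      rw [listShuffle_cons_cons, listShuffle_cons_cons, map_add, map_zsmul, ih₁, ih₂]

lemma map_cut (f : M →+ N) (l : List A) (G : List A → List A → M) :
    f (cut l G) = cut l fun u v => f (G u v) := by
  induction l generalizing G with
  | nil => simp
  | cons a l ih => rw [cut_cons, cut_cons, map_add, ih]

/-- Additivity is naturality under three homomorphisms from `M × M` to `M`: the two projections and
their sum. -/
lemma listShuffle_add (l₁ l₂ : List A) (F G : List A → M) :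
    listShuffle l₁ l₂ (fun w => F w + G w) = listShuffle l₁ l₂ F + listShuffle l₁ l₂ G := by
  have hF := map_listShuffle (AddMonoidHom.fst M M) l₁ l₂ fun w => (F w, G w)
  have hG := map_listShuffle (AddMonoidHom.snd M M) l₁ l₂ fun w => (F w, G w)
  have h := map_listShuffle (AddMonoidHom.fst M M + AddMonoidHom.snd M M) l₁ l₂
    fun w => (F w, G w)
  exact h.symm.trans (congrArg₂ (· + ·) hF hG)

lemma cut_add (l : List A) (F G : List A → List A → M) :
    cut l (fun u v => F u v + G u v) = cut l F + cut l G := by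
  have hF := map_cut (AddMonoidHom.fst M M) l fun u v => (F u v, G u v)
  have hG := map_cut (AddMonoidHom.snd M M) l fun u v => (F u v, G u v)
  have h := map_cut (AddMonoidHom.fst M M + AddMonoidHom.snd M M) l fun u v => (F u v, G u v)
  exact h.symm.trans (congrArg₂ (· + ·) hF hG)

lemma listShuffle_zsmul (c : ℤ) (l₁ l₂ : List A) (F : List A → M) :
    listShuffle l₁ l₂ (fun w => c • F w) = c • listShuffle l₁ l₂ F :=
  (map_listShuffle (zsmulAddGroupHom c) l₁ l₂ F).symm

lemma cut_zsmul (c : ℤ) (l : List A) (G : List A → List A → M) :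
    cut l (fun u v => c • G u v) = c • cut l G :=
  (map_cut (zsmulAddGroupHom c) l G).symm

lemma listShuffle_eq_zero {l₁ l₂ : List A} {F : List A → M}
    (h : ∀ w, w.Perm (l₁ ++ l₂) → F w = 0) : listShuffle l₁ l₂ F = 0 := by
  -- Zero is written as a multiple so that the scalar 0 can be pulled out of the shuffle.
  rw [listShuffle_congr (G := fun _ => (0 : ℤ) • (0 : M)) (by simpa using h), listShuffle_zsmul,
    zero_smul]

lemma listShuffle_cut {B : Type*} (l₁ l₂ : List A) (l : List B)
    (F : List A → List B → List B → M) :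
    listShuffle l₁ l₂ (fun w => cut l (F w)) =
      cut l fun u v => listShuffle l₁ l₂ fun w => F w u v := by
  induction l generalizing F with
  | nil => simp
  | cons a l ih => simp only [cut_cons, listShuffle_add, ih]

lemma listShuffle_comm {B : Type*} (l₁ l₂ : List A) (m₁ m₂ : List B) (F : List A → List B → M) :
    listShuffle l₁ l₂ (fun w => listShuffle m₁ m₂ (F w)) =
      listShuffle m₁ m₂ fun v => listShuffle l₁ l₂ fun w => F w v := by
  induction m₁ generalizing m₂ F with
  | nil => simp
  | cons a m₁ ih₁ =>
    induction m₂ generalizing F with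
    | nil => simp
    | cons b m₂ ih₂ =>
      simp only [listShuffle_cons_cons a b, listShuffle_add, listShuffle_zsmul, ih₁, ih₂]

lemma cut_comm {B : Type*} (l : List A) (m : List B) (F : List A → List A → List B → List B → M) :
    cut l (fun u v => cut m (F u v)) = cut m fun u' v' => cut l fun u v => F u v u' v' := by
  induction m generalizing F with
  | nil => simp
  | cons a m ih => simp only [cut_cons, cut_add, ih]

lemma listShuffle_map {B : Type*} (f : A → B) (l₁ l₂ : List A) (F : List B → M) :
    listShuffle (l₁.map f) (l₂.map f) F = listShuffle l₁ l₂ fun w => F (w.map f) := by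
  induction l₁ generalizing l₂ F with
  | nil => simp
  | cons a l₁ ih₁ =>
    induction l₂ generalizing F with
    | nil => simp
    | cons b l₂ ih₂ =>
      have h := ih₂ fun w => F (f b :: w)
      rw [List.map_cons] at h
      simp only [List.map_cons, listShuffle_cons_cons, List.length_map, h]
      rw [← List.map_cons, ih₁]

lemma cut_eq_sum (l : List A) (G : List A → List A → M) :
    cut l G = ∑ i ∈ Finset.range (l.length + 1), G (l.take i) (l.drop i) := by
  induction l generalizing G with
  | nil => simp
  | cons a l ih =>
    rw [cut_cons, ih, List.length_cons, Finset.sum_range_succ' _ (l.length + 1), add_comm]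
    simp

/-- Serves to discard the cuts that produce a zero step; `cut_eq_of_left` does the same on the other
side. -/
lemma cut_eq_of_right {l : List A} {G : List A → List A → M}
    (h : ∀ u v, u ++ v = l → v ≠ [] → G u v = 0) : cut l G = G l [] := by
  induction l generalizing G with
  | nil => simp
  | cons a l ih =>
    rw [cut_cons, h [] _ rfl (by simp), zero_add,
      ih fun u v huv hv => h (a :: u) v (by rw [List.cons_append, huv]) hv]

lemma cut_eq_of_left {l : List A} {G : List A → List A → M}
    (h : ∀ u v, u ++ v = l → u ≠ [] → G u v = 0) : cut l G = G [] l := by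
  cases l with
  | nil => simp
  | cons a l =>
    rw [cut_cons, cut_congr (G := fun _ _ => (0 : ℤ) • (0 : M)), cut_zsmul, zero_smul, add_zero]
    intro u v huv
    rw [smul_zero]
    exact h _ _ (by rw [List.cons_append, huv]) (by simp)

/-! ### Signed identities of the shuffle product -/

/-- Associativity of the shuffle product. -/
lemma listShuffle_assoc (l₁ l₂ l₃ : List A) (F : List A → M) :
    listShuffle l₁ l₂ (fun w => listShuffle w l₃ F) =
      listShuffle l₂ l₃ fun w => listShuffle l₁ w F := by
  induction l₁ generalizing l₂ l₃ F with
  | nil => simp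
  | cons a l₁ ih₁ =>
    induction l₂ generalizing l₃ F with
    | nil => simp
    | cons b l₂ ih₂ =>
      induction l₃ generalizing F with
      | nil => simp
      | cons c l₃ ih₃ =>
        -- Putting `c` in front moves it past all of `a :: w`, whose length does not depend on the
        -- shuffle `w`; the sign is therefore constant and can be pulled out.
        have h₁ : listShuffle l₁ (b :: l₂) (fun w => listShuffle (a :: w) (c :: l₃) F) =
            listShuffle l₁ (b :: l₂) (fun w => listShuffle w (c :: l₃) fun w => F (a :: w)) +
            (-1 : ℤ) ^ (l₁.length + l₂.length + 2) • listShuffle l₁ (b :: l₂)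
              (fun w => listShuffle (a :: w) l₃ fun w => F (c :: w)) := by
          rw [← listShuffle_zsmul, ← listShuffle_add]
          refine listShuffle_congr fun w hw => ?_
          have := hw.length_eq
          rw [listShuffle_cons_cons, show w.length + 1 = l₁.length + l₂.length + 2 by
            simp at this; omega]
        have h₂ : listShuffle (a :: l₁) l₂ (fun w => listShuffle (b :: w) (c :: l₃) F) =
            listShuffle (a :: l₁) l₂ (fun w => listShuffle w (c :: l₃) fun w => F (b :: w)) +
            (-1 : ℤ) ^ (l₁.length + l₂.length + 2) • listShuffle (a :: l₁) l₂
              (fun w => listShuffle (b :: w) l₃ fun w => F (c :: w)) := by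
          rw [← listShuffle_zsmul, ← listShuffle_add]
          refine listShuffle_congr fun w hw => ?_
          have := hw.length_eq
          rw [listShuffle_cons_cons, show w.length + 1 = l₁.length + l₂.length + 2 by
            simp at this; omega]
        -- The terms starting with `c` in `h₁` and `h₂` together make up the shuffle of `a :: l₁`,
        -- `b :: l₂` and `l₃`, to which the innermost induction applies.
        have h₃ := ih₃ fun w => F (c :: w)
        rw [listShuffle_cons_cons] at h₃
        rw [listShuffle_cons_cons a b, h₁, h₂, listShuffle_cons_cons b c, ih₁, ih₂]
        simp only [listShuffle_cons_cons a, listShuffle_add, listShuffle_zsmul]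
        rw [listShuffle_cons_cons b c, ← h₃]
        simp only [smul_add, smul_smul]
        module

/-- The cuts of the shuffles of two lists. -/
lemma listShuffle_cut_self (l₁ l₂ : List A) (G : List A → List A → M) :
    listShuffle l₁ l₂ (fun w => cut w G) = cut l₁ fun u₁ v₁ => cut l₂ fun u₂ v₂ =>
      (-1 : ℤ) ^ (u₂.length * v₁.length) •
        listShuffle u₁ u₂ fun u => listShuffle v₁ v₂ fun v => G u v := by
  induction l₁ generalizing l₂ G with
  | nil => simp
  | cons a l₁ ih₁ =>
    induction l₂ generalizing G with
    | nil => simp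
    | cons b l₂ ih₂ =>
      -- When `b` comes first it crosses all of `a :: l₁`. The crossing of `v₁` belongs to the sign
      -- of the cut, the crossing of `a :: u₁` to the shuffle of the first parts.
      have h : (-1 : ℤ) ^ (l₁.length + 1) • (cut l₁ fun u₁ v₁ => cut l₂ fun u₂ v₂ =>
            (-1 : ℤ) ^ (u₂.length * v₁.length) • listShuffle (a :: u₁) u₂ fun u =>
              listShuffle v₁ v₂ fun v => G (b :: u) v) =
          cut l₁ fun u₁ v₁ => cut l₂ fun u₂ v₂ =>
            (-1 : ℤ) ^ ((u₂.length + 1) * v₁.length) • (-1 : ℤ) ^ (u₁.length + 1) •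
              listShuffle (a :: u₁) u₂ fun u => listShuffle v₁ v₂ fun v => G (b :: u) v := by
        rw [← cut_zsmul]
        refine cut_congr fun u₁ v₁ h => ?_
        rw [← cut_zsmul]
        congr! 3 with u₂ v₂
        rw [← h, List.length_append, smul_smul, smul_smul]
        congr 1
        ring
      -- The same for the cuts in which all of `a :: l₁` lies in the second part.
      have h' : (-1 : ℤ) ^ (l₁.length + 1) • (cut l₂ fun u₂ v₂ =>
            (-1 : ℤ) ^ (u₂.length * (l₁.length + 1)) • listShuffle (a :: l₁) v₂ fun v =>
              G (b :: u₂) v) =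
          cut l₂ fun u₂ v₂ => (-1 : ℤ) ^ ((u₂.length + 1) * (l₁.length + 1)) •
            listShuffle (a :: l₁) v₂ fun v => G (b :: u₂) v := by
        rw [← cut_zsmul]
        congr! 3 with u₂ v₂
        rw [smul_smul]
        congr 1
        ring
      rw [listShuffle_cons_cons]
      simp only [cut_cons a, cut_cons b, listShuffle_add, ih₁, ih₂]
      simp only [cut_add, listShuffle_cons_cons a b, List.length_nil, zero_mul, pow_zero,
        one_smul, listShuffle_nil_left, listShuffle_nil_right, smul_add, List.length_cons, h, h']
      abel

/-- A shuffle with a list that contains a marked entry, split at that entry. -/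
lemma listShuffle_append_cons_right (l₁ l₂ l₃ : List A) (c : A) (F : List A → M) :
    listShuffle l₁ (l₂ ++ c :: l₃) F = cut l₁ fun u₁ v₁ =>
      (-1 : ℤ) ^ ((l₂.length + 1) * v₁.length) •
        listShuffle u₁ l₂ fun u => listShuffle v₁ l₃ fun v => F (u ++ c :: v) := by
  induction l₁ generalizing l₂ F with
  | nil => simp
  | cons a l₁ ih₁ =>
    induction l₂ generalizing F with
    | nil =>
      have h := ih₁ [] fun w => F (a :: w)
      rw [List.nil_append] at h ⊢
      rw [listShuffle_cons_cons, h, cut_cons]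
      simp [add_comm]
    | cons b l₂ ih₂ =>
      -- Again the crossing of `a :: l₁` by `b` splits into a crossing of `v₁`, which raises the
      -- exponent of the cut, and a crossing of `a :: u₁`.
      have h : (-1 : ℤ) ^ (l₁.length + 1) • (cut l₁ fun u₁ v₁ =>
            (-1 : ℤ) ^ ((l₂.length + 1) * v₁.length) • listShuffle (a :: u₁) l₂ fun u =>
              listShuffle v₁ l₃ fun v => F (b :: (u ++ c :: v))) =
          cut l₁ fun u₁ v₁ => (-1 : ℤ) ^ ((l₂.length + 1 + 1) * v₁.length) •
            (-1 : ℤ) ^ (u₁.length + 1) •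
              listShuffle (a :: u₁) l₂ fun u => listShuffle v₁ l₃ fun v =>
                F (b :: (u ++ c :: v)) := by
        rw [← cut_zsmul]
        refine cut_congr fun u₁ v₁ h => ?_
        rw [← h, List.length_append, smul_smul, smul_smul]
        congr 1
        ring
      have h' := ih₁ (b :: l₂) fun w => F (a :: w)
      rw [List.cons_append] at h' ⊢
      rw [listShuffle_cons_cons, h', ih₂]
      simp only [cut_cons a, listShuffle_cons_cons, smul_add, cut_add, List.length_cons,
        listShuffle_nil_left, List.cons_append, smul_smul, h]
      simp only [← smul_smul]
      rw [← h]
      module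

/-- A shuffle with a list that contains a marked entry, split at that entry. -/
lemma listShuffle_append_cons_left (l₁ l₂ l₃ : List A) (c : A) (F : List A → M) :
    listShuffle (l₁ ++ c :: l₃) l₂ F = cut l₂ fun u₂ v₂ =>
      (-1 : ℤ) ^ (u₂.length * (l₃.length + 1)) •
        listShuffle l₁ u₂ fun u => listShuffle l₃ v₂ fun v => F (u ++ c :: v) := by
  induction l₁ generalizing l₂ F with
  | nil =>
    induction l₂ generalizing F with
    | nil => simp
    | cons b l₂ ih₂ =>
      have h := ih₂ fun w => F (b :: w)
      rw [List.nil_append] at h ⊢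
      rw [listShuffle_cons_cons, h, cut_cons, ← cut_zsmul]
      simp only [List.length_nil, zero_mul, pow_zero, one_smul, listShuffle_nil_left,
        listShuffle_nil_right, List.nil_append, List.length_cons, smul_smul, List.cons_append]
      congr 1
      refine cut_congr fun u₂ v₂ _ => ?_
      congr 1
      ring
  | cons a l₁ ih₁ =>
    induction l₂ generalizing F with
    | nil => simp
    | cons b l₂ ih₂ =>
      have h : (-1 : ℤ) ^ ((l₁ ++ c :: l₃).length + 1) • (cut l₂ fun u₂ v₂ =>
            (-1 : ℤ) ^ (u₂.length * (l₃.length + 1)) • listShuffle (a :: l₁) u₂ fun u =>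
              listShuffle l₃ v₂ fun v => F (b :: (u ++ c :: v))) =
          cut l₂ fun u₂ v₂ => (-1 : ℤ) ^ ((u₂.length + 1) * (l₃.length + 1)) •
            (-1 : ℤ) ^ (l₁.length + 1) •
              listShuffle (a :: l₁) u₂ fun u => listShuffle l₃ v₂ fun v =>
                F (b :: (u ++ c :: v)) := by
        rw [← cut_zsmul]
        congr! 3 with u₂ v₂
        rw [smul_smul, smul_smul, List.length_append, List.length_cons]
        congr 1
        ring
      have h' := ih₂ fun w => F (b :: w)
      rw [List.cons_append] at h' ⊢
      rw [listShuffle_cons_cons, ih₁, h', h]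
      simp only [cut_cons b, listShuffle_cons_cons, smul_add, cut_add, List.length_cons,
        List.length_nil, listShuffle_nil_right, List.cons_append]
      abel

/-! ### The homotopy on words and its compatibility with shuffles -/

variable [AddCommMonoid A]

/-- The combinatorial form of the Eilenberg–Mac Lane homotopy: `l` is the list of steps of a simplex
of a product, `π₁` and `π₂` are the projections of steps to the two factors, and `F` is the
function that sends a list of steps to a simplex. -/
def listHomotopy (π₁ π₂ : A →+ A) (F : List A → M) (l : List A) : M :=
  cut l fun u v => cut v fun s t => (-1 : ℤ) ^ u.length •
    listShuffle (s.map π₁) (t.map π₂) fun w => F (u ++ π₂ s.sum :: w)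

lemma map_listHomotopy (f : M →+ N) (π₁ π₂ : A →+ A) (F : List A → M) (l : List A) :
    f (listHomotopy π₁ π₂ F l) = listHomotopy π₁ π₂ (fun w => f (F w)) l := by
  simp only [listHomotopy, map_cut, map_zsmul, map_listShuffle]

/-- The submonoid records which steps can occur: if it contains the steps of `l` and is stable under
both projections, it also contains the inserted step and the projected ones. -/
lemma listHomotopy_congr {π₁ π₂ : A →+ A} {F G : List A → M} {l : List A} (S : AddSubmonoid A)
    (h₁ : ∀ a ∈ S, π₁ a ∈ S) (h₂ : ∀ a ∈ S, π₂ a ∈ S) (hl : ∀ a ∈ l, a ∈ S)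
    (h : ∀ w, w.length = l.length + 1 → (∀ a ∈ w, a ∈ S) → F w = G w) :
    listHomotopy π₁ π₂ F l = listHomotopy π₁ π₂ G l := by
  refine cut_congr fun u v huv => cut_congr fun s t hst => ?_
  congr 1
  refine listShuffle_congr fun w hw => h _ ?_ fun a ha => ?_
  · have := hw.length_eq
    simp only [← huv, ← hst, List.length_append, List.length_cons, List.length_map] at this ⊢
    omega
  · subst huv hst
    simp only [List.mem_append] at hl
    rcases List.mem_append.1 ha with ha | ha
    · exact hl a (Or.inl ha)
    rcases List.mem_cons.1 ha with rfl | ha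
    · exact h₂ _ (AddSubmonoid.list_sum_mem _ fun a ha => hl a (Or.inr (Or.inl ha)))
    rcases List.mem_append.1 (hw.mem_iff.1 ha) with ha | ha
    · obtain ⟨b, hb, rfl⟩ := List.mem_map.1 ha
      exact h₁ _ (hl b (Or.inr (Or.inl hb)))
    · obtain ⟨b, hb, rfl⟩ := List.mem_map.1 ha
      exact h₂ _ (hl b (Or.inr (Or.inr hb)))

lemma listHomotopy_shuffle_left {π₁ π₂ : A →+ A} {F : List A → M} (l₁ l₂ : List A)
    (hF : ∀ w, w.length = l₁.length + l₂.length + 1 → 0 ∈ w → F w = 0)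
    (h₁ : ∀ a ∈ l₁, π₁ a = a) (h₂ : ∀ a ∈ l₁, π₂ a = 0) :
    listShuffle l₁ l₂ (listHomotopy π₁ π₂ F) =
      (-1 : ℤ) ^ l₁.length • listHomotopy π₁ π₂ (fun w => listShuffle l₁ w F) l₂ := by
  have hL : listShuffle l₁ l₂ (listHomotopy π₁ π₂ F) = cut l₁ fun u₁ v₁ => cut l₂ fun u₂ v₂ =>
      cut v₂ fun s t => (-1 : ℤ) ^ (u₂.length * v₁.length + u₁.length + u₂.length) •
        listShuffle u₁ u₂ fun u => listShuffle v₁ (s.map π₁) fun w =>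
          listShuffle w (t.map π₂) fun w => F (u ++ π₂ s.sum :: w) := by
    unfold listHomotopy
    rw [listShuffle_cut_self]
    refine cut_congr fun u₁ v₁ h => cut_congr fun u₂ v₂ h' => ?_
    simp only [listShuffle_cut_self v₁, listShuffle_cut, ← cut_zsmul]
    -- Only cuts of `v₁` with empty second part survive; otherwise `π₂` turns a step of `l₁` into
    -- zero.
    rw [cut_eq_of_right]
    · refine cut_congr fun s t _ => ?_
      simp only [List.length_nil, mul_zero, pow_zero, one_smul, listShuffle_nil_left]
      rw [pow_add, pow_add, mul_assoc, mul_smul, ← pow_add, ← listShuffle_zsmul (_ ^ (_ + _))]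
      congr 1
      refine listShuffle_congr fun u hu => ?_
      rw [hu.length_eq, List.length_append, listShuffle_zsmul]
      congr 1
      have hv : v₁ = v₁.map π₁ := by
        rw [List.map_congr_left (g := id), List.map_id]
        exact fun a ha => h₁ a (by simp [← h, ha])
      conv_rhs => rw [hv, listShuffle_map]
      refine listShuffle_congr fun w hw => ?_
      -- The steps of `l₁` in the middle part do not contribute to the inserted step.
      have h0 : (v₁.map π₂).sum = 0 := List.sum_eq_zero fun x hx => by
        obtain ⟨a, ha, rfl⟩ := List.mem_map.1 hx
        exact h₂ a (by simp [← h, ha])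
      rw [hw.sum_eq, List.sum_append, map_add, map_list_sum, h0, zero_add]
    · intro s₁ t₁ hst ht
      rw [cut_congr (G := fun _ _ => (0 : ℤ) • (0 : M)), cut_zsmul, zero_smul]
      intro s t hst'
      obtain ⟨a, ha⟩ := List.exists_mem_of_ne_nil _ ht
      rw [listShuffle_eq_zero, smul_zero, smul_zero]
      intro u hu
      rw [smul_eq_zero_of_right]
      refine listShuffle_eq_zero fun w hw => listShuffle_eq_zero fun r hr => ?_
      rw [listShuffle_eq_zero, smul_zero]
      intro x hx
      refine hF _ ?_ ?_
      · have e₁ := hu.length_eq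
        have e₂ := hw.length_eq
        have e₃ := hr.length_eq
        have e₄ := hx.length_eq
        simp only [← h, ← h', ← hst, ← hst', List.length_append, List.length_cons,
          List.length_map] at *
        omega
      have h0 : (0 : A) ∈ x := by
        refine hx.mem_iff.2 (List.mem_append_right _ (List.mem_map.2 ⟨a, hr.mem_iff.2 ?_, ?_⟩))
        · simp [ha]
        · exact h₂ a (by simp [← h, ← hst, ha])
      simp [h0]
  rw [hL]
  unfold listHomotopy
  -- The other side: a shuffle of `l₁` with a word of H(`l₂`) is split at the inserted step.
  simp only [listShuffle_append_cons_right]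
  rw [cut_comm, ← cut_zsmul]
  refine cut_congr fun u₂ v₂ _ => ?_
  rw [cut_comm, ← cut_zsmul]
  refine cut_congr fun s t _ => ?_
  rw [listShuffle_cut, ← cut_zsmul, ← cut_zsmul]
  refine cut_congr fun u₁ v₁ h => ?_
  simp only [listShuffle_assoc v₁]
  rw [listShuffle_comm, listShuffle_zsmul, smul_smul, smul_smul, ← h, List.length_append]
  congr 1
  -- The factor (-1)^|`l₁`| compensates for `v₁` crossing the inserted step: the exponents differ by
  -- 2|`v₁`|.
  rw [← pow_add, ← pow_add, show u₁.length + v₁.length + u₂.length + (u₂.length + 1) * v₁.length =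
    u₂.length * v₁.length + u₁.length + u₂.length + (v₁.length + v₁.length) by ring,
    pow_add _ _ (v₁.length + v₁.length), Even.neg_one_pow ⟨_, rfl⟩, mul_one]

lemma listHomotopy_shuffle_right {π₁ π₂ : A →+ A} {F : List A → M} (l₁ l₂ : List A)
    (hF : ∀ w, w.length = l₁.length + l₂.length + 1 → 0 ∈ w → F w = 0)
    (h₁ : ∀ a ∈ l₂, π₁ a = 0) (h₂ : ∀ a ∈ l₂, π₂ a = a) :
    listShuffle l₁ l₂ (listHomotopy π₁ π₂ F) =
      listHomotopy π₁ π₂ (fun w => listShuffle w l₂ F) l₁ := by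
  have hL : listShuffle l₁ l₂ (listHomotopy π₁ π₂ F) = cut l₁ fun u₁ v₁ => cut l₂ fun u₂ v₂ =>
      cut v₁ fun s t => (-1 : ℤ) ^ (u₂.length * v₁.length + u₁.length + u₂.length) •
        listShuffle u₁ u₂ fun u => listShuffle (t.map π₂) v₂ fun w =>
          listShuffle (s.map π₁) w fun w => F (u ++ π₂ s.sum :: w) := by
    unfold listHomotopy
    rw [listShuffle_cut_self]
    refine cut_congr fun u₁ v₁ h' => cut_congr fun u₂ v₂ h => ?_
    simp only [listShuffle_cut_self v₁, listShuffle_cut, ← cut_zsmul]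
    refine cut_congr fun s t hst => ?_
    -- Dually, a step of `l₂` in the middle part becomes zero under `π₁`, so `l₂` meets only the
    -- first and last parts.
    rw [cut_eq_of_left]
    · simp only [List.length_nil, zero_mul, pow_zero, one_smul, listShuffle_nil_right]
      rw [pow_add, pow_add, mul_assoc, mul_smul, ← pow_add, ← listShuffle_zsmul (_ ^ (_ + _))]
      congr 1
      refine listShuffle_congr fun u hu => ?_
      rw [hu.length_eq, List.length_append, listShuffle_zsmul]
      congr 1
      have hv : v₂ = v₂.map π₂ := by
        rw [List.map_congr_left (g := id), List.map_id]
        exact fun a ha => h₂ a (by simp [← h, ha])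
      conv_rhs => rw [hv, listShuffle_map]
    · intro s₂ t₂ hst₂ hs
      obtain ⟨a, ha⟩ := List.exists_mem_of_ne_nil _ hs
      rw [listShuffle_eq_zero, smul_zero]
      intro u hu
      rw [smul_eq_zero_of_right]
      refine listShuffle_eq_zero fun r hr => listShuffle_eq_zero fun w hw => ?_
      rw [listShuffle_eq_zero, smul_zero]
      intro x hx
      refine hF _ ?_ ?_
      · have e₁ := hu.length_eq
        have e₂ := hw.length_eq
        have e₃ := hr.length_eq
        have e₄ := hx.length_eq
        simp only [← h, ← h', ← hst, ← hst₂, List.length_append, List.length_cons,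
          List.length_map] at *
        omega
      have h0 : (0 : A) ∈ x := by
        refine hx.mem_iff.2 (List.mem_append_left _ (List.mem_map.2 ⟨a, hr.mem_iff.2 ?_, ?_⟩))
        · simp [ha]
        · exact h₁ a (by simp [← h, ← hst₂, ha])
      simp [h0]
  rw [hL]
  unfold listHomotopy
  simp only [listShuffle_append_cons_left]
  refine cut_congr fun u₁ v₁ _ => ?_
  rw [cut_comm]
  refine cut_congr fun s t h => ?_
  rw [listShuffle_cut, ← cut_zsmul]
  refine cut_congr fun u₂ v₂ _ => ?_
  simp only [← listShuffle_assoc (s.map π₁)]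
  rw [listShuffle_comm, ← listShuffle_zsmul, ← listShuffle_zsmul]
  -- Every `w` has length |`v₁`|, so the sign of the split at the inserted step is the same for all
  -- of them.
  refine listShuffle_congr fun w hw => ?_
  rw [smul_smul, hw.length_eq, List.length_append, List.length_map, List.length_map,
    ← List.length_append, h]
  congr 1
  ring

end Lists

/-! ### Shuffles of lists and shuffles of sets -/

section Merge

variable {A M : Type*} [AddCommGroup M]

/-- The shuffle of two lists described by a word `w`: it takes the next entry of the first list
where `w` is `true` and of the second one where `w` is `false`. -/
def merge (w : List Bool) (l₁ l₂ : List A) : List A :=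
  match w, l₁, l₂ with
  | true :: w, a :: l₁, l₂ => a :: merge w l₁ l₂
  | false :: w, l₁, b :: l₂ => b :: merge w l₁ l₂
  | _, l₁, l₂ => l₁ ++ l₂

@[simp] lemma merge_nil_left (w : List Bool) (l : List A) : merge w [] l = l := by
  induction w generalizing l with
  | nil => simp [merge]
  | cons c w ih => cases c <;> cases l <;> simp [merge, ih]

@[simp] lemma merge_nil_right (w : List Bool) (l : List A) : merge w l [] = l := by
  induction w generalizing l with
  | nil => simp [merge]
  | cons c w ih => cases c <;> cases l <;> simp [merge, ih]

/-- The two counting hypotheses ensure that the word never asks for an entry of an exhausted list,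
so the fallback clause of `merge` plays no role. -/
lemma sum_take_merge [AddCommMonoid A] (w : List Bool) (l₁ l₂ : List A)
    (h₁ : w.count true = l₁.length) (h₂ : w.count false = l₂.length) (j : ℕ) :
    ((merge w l₁ l₂).take j).sum =
      (l₁.take ((w.take j).count true)).sum + (l₂.take ((w.take j).count false)).sum := by
  induction w generalizing l₁ l₂ j with
  | nil =>
    have h₁' : l₁ = [] := List.length_eq_zero_iff.1 (by simpa using h₁.symm)
    have h₂' : l₂ = [] := List.length_eq_zero_iff.1 (by simpa using h₂.symm)
    simp [h₁', h₂']
  | cons c w ih =>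
    cases j with
    | zero => simp
    | succ j =>
      cases c with
      | true =>
        cases l₁ with
        | nil => simp at h₁
        | cons a l₁ =>
          simp only [merge, List.take_succ_cons, List.sum_cons]
          rw [ih l₁ l₂ (by simpa using h₁) (by simpa using h₂)]
          simp [add_assoc]
      | false =>
        cases l₂ with
        | nil => simp at h₂
        | cons a l₂ =>
          simp only [merge, List.take_succ_cons, List.sum_cons]
          rw [ih l₁ l₂ (by simpa using h₁) (by simpa using h₂)]
          simp [add_left_comm]

/-- The word that describes the subset `α ∩ {0, …, n - 1}` of `{0, …, n - 1}`. -/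
def wordOf (n : ℕ) (α : Finset ℕ) : List Bool := (List.range n).map fun i => decide (i ∈ α)

lemma wordOf_succ (n : ℕ) (α : Finset ℕ) :
    wordOf (n + 1) α = wordOf n α ++ [decide (n ∈ α)] := by
  simp [wordOf, List.range_succ]

lemma take_wordOf (n j : ℕ) (α : Finset ℕ) (hj : j ≤ n) : (wordOf n α).take j = wordOf j α := by
  rw [wordOf, ← List.map_take, List.take_range, min_eq_left hj, wordOf]

lemma count_false_wordOf (n : ℕ) (α : Finset ℕ) :
    (wordOf n α).count false = (Finset.range n \ α).card := by
  induction n with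
  | zero => simp [wordOf]
  | succ n ih =>
    rw [wordOf_succ, List.count_append, ih]
    by_cases h : n ∈ α
    · simp [h, card_range_succ_sdiff_of_mem]
    · simp [h, card_range_succ_sdiff_of_notMem]

/-- The number of letters read from a list is the vertex that `degeneracyHom` assigns to the
complementary set; this links words to iterated degeneracies. -/
lemma count_true_wordOf (n p q : ℕ) (α : Finset ℕ) (hn : n ≤ p + q) :
    (wordOf n α).count true = (Finset.range n \ shuffleCompl p q α).card := by
  induction n with
  | zero => simp [wordOf]
  | succ n ih =>
    rw [wordOf_succ, List.count_append, ih (by omega)]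
    by_cases h : n ∈ α
    · rw [card_range_succ_sdiff_of_notMem _ _ (by simp [shuffleCompl, h])]
      simp [h]
    · rw [card_range_succ_sdiff_of_mem _ _ (by simp [shuffleCompl, h]; omega)]
      simp [h]

/-- As a double sum over j < i, the number of inversions allows the index 0 to be split off, as the
recursion of `listShuffle` requires. -/
lemma shuffleSign_eq_sum (p q : ℕ) (α : Finset ℕ) (hα : α ⊆ Finset.range (p + q)) :
    shuffleSign p q α = (-1) ^ ∑ i ∈ Finset.range (p + q), ∑ j ∈ Finset.range i,
      if i ∈ α ∧ j ∉ α then 1 else 0 := by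
  rw [shuffleSign, Finset.card_filter, Finset.sum_product]
  congr 1
  rw [← Finset.sum_subset hα]
  · refine Finset.sum_congr rfl fun i hi => ?_
    have hi' := Finset.mem_range.1 (hα hi)
    rw [← Finset.sum_filter, ← Finset.sum_filter]
    congr 1
    ext j
    simp [shuffleCompl, hi]
    constructor
    · rintro ⟨⟨h1, h2⟩, h3⟩; exact ⟨h3, h2⟩
    · rintro ⟨h3, h2⟩; exact ⟨⟨by omega, h2⟩, h3⟩
  · intro i _ hi
    simp [hi]

/-- The set obtained from `α` by adding `1` to all elements. -/
def shift (α : Finset ℕ) : Finset ℕ := α.map ⟨Nat.succ, Nat.succ_injective⟩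

@[simp] lemma succ_mem_shift (α : Finset ℕ) (i : ℕ) : i + 1 ∈ shift α ↔ i ∈ α := by simp [shift]

@[simp] lemma zero_notMem_shift (α : Finset ℕ) : 0 ∉ shift α := by simp [shift]

/-- The two sums are over the sets that contain 0 and those that do not, that is, over the two
choices of the first letter. -/
lemma sum_shuffles_succ {p n : ℕ} (f : Finset ℕ → M) :
    ∑ α ∈ (Finset.range (n + 1)).powersetCard (p + 1), f α =
      ∑ α ∈ (Finset.range n).powersetCard p, f (insert 0 (shift α)) +
        ∑ α ∈ (Finset.range n).powersetCard (p + 1), f (shift α) := by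
  have h : Finset.range (n + 1) = insert 0 (shift (Finset.range n)) := by
    ext i
    cases i <;> simp
  have h0 : (0 : ℕ) ∉ shift (Finset.range n) := by simp
  rw [h, Finset.powersetCard_succ_insert h0, Finset.sum_union, add_comm, Finset.sum_image]
  · simp only [shift, Finset.powersetCard_map, Finset.sum_map, Finset.mapEmbedding_apply,
      RelEmbedding.coe_toEmbedding]
  · intro α hα β hβ h
    have hα' : 0 ∉ α := fun h => h0 ((Finset.mem_powersetCard.1 hα).1 h)
    have hβ' : 0 ∉ β := fun h => h0 ((Finset.mem_powersetCard.1 hβ).1 h)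
    rw [← Finset.erase_insert hα', ← Finset.erase_insert hβ', h]
  · rw [Finset.disjoint_left]
    intro α hα hβ
    obtain ⟨β, _, rfl⟩ := Finset.mem_image.1 hβ
    exact h0 ((Finset.mem_powersetCard.1 hα).1 (Finset.mem_insert_self _ _))

lemma wordOf_insert_shift (n : ℕ) (α : Finset ℕ) :
    wordOf (n + 1) (insert 0 (shift α)) = true :: wordOf n α := by
  simp [wordOf, List.range_succ_eq_map, Function.comp_def]

lemma wordOf_shift (n : ℕ) (α : Finset ℕ) : wordOf (n + 1) (shift α) = false :: wordOf n α := by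
  simp [wordOf, List.range_succ_eq_map, Function.comp_def]

lemma shift_subset {α : Finset ℕ} {n : ℕ} (hα : α ⊆ Finset.range n) :
    shift α ⊆ Finset.range (n + 1) := by
  intro i hi
  cases i with
  | zero => simp
  | succ i => simpa using hα ((succ_mem_shift α i).1 hi)

/-- An element 0 of `α` has nothing before it and adds no inversion. -/
lemma shuffleSign_insert_shift (p q : ℕ) (α : Finset ℕ) (hα : α ⊆ Finset.range (p + (q + 1))) :
    shuffleSign (p + 1) (q + 1) (insert 0 (shift α)) = shuffleSign p (q + 1) α := by
  rw [shuffleSign_eq_sum _ _ _ hα, shuffleSign_eq_sum,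
    show p + 1 + (q + 1) = p + (q + 1) + 1 by ring]
  · congr 1
    rw [Finset.sum_range_succ']
    simp only [Finset.sum_range_succ' _ (_ : ℕ)]
    simp
  · rw [show p + 1 + (q + 1) = p + (q + 1) + 1 by ring]
    exact Finset.insert_subset (by simp) (shift_subset hα)

/-- If 0 lies in the complement, it forms an inversion with each of the `p + 1` elements of `α`. -/
lemma shuffleSign_shift (p q : ℕ) (α : Finset ℕ) (hα : α ∈ shuffles (p + 1) q) :
    shuffleSign (p + 1) (q + 1) (shift α) = (-1) ^ (p + 1) * shuffleSign (p + 1) q α := by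
  obtain ⟨hα, hc⟩ := Finset.mem_powersetCard.1 hα
  rw [shuffleSign_eq_sum _ _ _ hα, shuffleSign_eq_sum, ← add_assoc, ← pow_add]
  · congr 1
    rw [Finset.sum_range_succ']
    simp only [Finset.sum_range_succ' _ (_ : ℕ), Finset.sum_add_distrib]
    simp [add_comm _ (p + 1), Finset.inter_eq_right.2 hα, hc]
  · exact shift_subset hα

lemma sum_shuffles_eq_listShuffle (l₁ l₂ : List A) (F : List A → M) :
    ∑ α ∈ shuffles l₁.length l₂.length, shuffleSign l₁.length l₂.length α •
      F (merge (wordOf (l₁.length + l₂.length) α) l₁ l₂) = listShuffle l₁ l₂ F := by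
  induction l₁ generalizing l₂ F with
  | nil => simp [shuffles, shuffleSign]
  | cons a l₁ ih₁ =>
    induction l₂ generalizing F with
    | nil =>
      have : (Finset.range (l₁.length + 1)).powersetCard (l₁.length + 1) =
          {Finset.range (l₁.length + 1)} := by
        simpa using Finset.powersetCard_self (Finset.range (l₁.length + 1))
      simp [shuffles, shuffleSign, this, shuffleCompl]
    | cons b l₂ ih₂ =>
      rw [listShuffle_cons_cons, ← ih₁, ← ih₂, Finset.smul_sum]
      simp only [List.length_cons]
      rw [shuffles, show l₁.length + 1 + (l₂.length + 1) = l₁.length + (l₂.length + 1) + 1 by ring,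
        sum_shuffles_succ]
      refine congrArg₂ (· + ·) (Finset.sum_congr rfl fun α hα => ?_) ?_
      · rw [shuffleSign_insert_shift _ _ _ (Finset.mem_powersetCard.1 hα).1, wordOf_insert_shift,
          merge]
      · rw [shuffles, show l₁.length + (l₂.length + 1) = l₁.length + 1 + l₂.length by ring]
        refine Finset.sum_congr rfl fun α hα => ?_
        rw [shuffleSign_shift _ _ _ hα, wordOf_shift, merge, mul_smul]

end Merge

/-! ### Simplices described by lists of steps -/

section Families

variable {A : Type*} [AddCommMonoid A]

/-- The monotone map `[N] → [n]` whose value at `j` is the sum of the first `j` entries of a list of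
steps, measured by `c` (and cut off at `n`). -/
def pathHom (c : A →+ ℕ) (l : List A) (N n : ℕ) : ⦋N⦌ ⟶ ⦋n⦌ :=
  SimplexCategory.mkHom
    { toFun := fun j => ⟨min (c (l.take j).sum) n, by omega⟩
      monotone' := fun i j hij => by
        have h : (i : ℕ) ≤ j := by exact_mod_cast hij
        obtain ⟨d, hd⟩ := Nat.exists_eq_add_of_le h
        have : c (l.take i).sum ≤ c (l.take j).sum := by
          rw [hd, List.take_add, List.sum_append, map_add]
          exact Nat.le_add_right _ _
        simp only [Fin.mk_le_mk]
        omega }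

lemma pathHom_apply (c : A →+ ℕ) (l : List A) (N n : ℕ) (j : Fin (N + 1)) :
    ((pathHom c l N n).toOrderHom j : ℕ) = min (c (l.take j).sum) n := rfl

/-- A family of simplices `σ N l` of `P`, indexed by dimensions `N` and lists of steps `l`, in which
the vertices of `σ N l` depend, compatibly with the simplicial structure, only on the images under
`π` of the partial sums of `l`. -/
def IsWordFamily (P : SSet.{u}) (π : A →+ A) (σ : ∀ N : ℕ, List A → P _⦋N⦌) : Prop :=
  ∀ ⦃N N' : ℕ⦄ (f : ⦋N'⦌ ⟶ ⦋N⦌) (l l' : List A),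
    (∀ j : Fin (N' + 1), π (l'.take j).sum = π (l.take (f.toOrderHom j : Fin (N + 1))).sum) →
      P.map f.op (σ N l) = σ N' l'

lemma isWordFamily_path {X : SSet.{u}} {n : ℕ} (x : X _⦋n⦌) (c : A →+ ℕ) (π : A →+ A)
    (h : ∀ a, c (π a) = c a) : IsWordFamily X π fun N l => X.map (pathHom c l N n).op x := by
  intro N N' f l l' hl
  have hf : f ≫ pathHom c l N n = pathHom c l' N' n := by
    apply hom_ext_val
    intro j
    change ((pathHom c l N n).toOrderHom (f.toOrderHom j) : ℕ) = _
    rw [pathHom_apply, pathHom_apply, ← h, ← hl, h]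
  rw [map_map, hf]

lemma IsWordFamily.pair {P Q : SSet.{u}} {π : A →+ A} {σ : ∀ N : ℕ, List A → P _⦋N⦌}
    {τ : ∀ N : ℕ, List A → Q _⦋N⦌} (hσ : IsWordFamily P π σ) (hτ : IsWordFamily Q π τ) :
    IsWordFamily (P ⊗ Q : SSet.{u}) π fun N l => EilenbergZilber.pair (σ N l) (τ N l) :=
  fun _ _ f l l' hl => Prod.ext (hσ f l l' hl) (hτ f l l' hl)

/-- Since `π` factors through `π'`, agreement of partial sums under `π'` is the stronger condition.
This brings factors that see different coordinates under a common projection. -/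
lemma IsWordFamily.mono {P : SSet.{u}} {π π' : A →+ A} {σ : ∀ N : ℕ, List A → P _⦋N⦌}
    (hσ : IsWordFamily P π σ) (h : ∀ a, π (π' a) = π a) : IsWordFamily P π' σ :=
  fun _ _ f l l' hl => hσ f l l' fun j => by rw [← h, hl, h]

/-- A zero step repeats a partial sum, so the simplex is a degeneracy of the one whose word omits
that step. -/
lemma IsWordFamily.degenerate {P : SSet.{u}} {π : A →+ A} {σ : ∀ N : ℕ, List A → P _⦋N⦌}
    (hσ : IsWordFamily P π σ) {N : ℕ} {l : List A} (hl : l.length = N) (h0 : 0 ∈ l) :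
    σ N l ∈ P.degenerate N := by
  obtain ⟨l₁, l₂, rfl⟩ := List.append_of_mem h0
  rw [List.length_append, List.length_cons, ← add_assoc] at hl
  subst hl
  refine ⟨l₁.length + l₂.length, by omega,
    SimplexCategory.σ (⟨l₁.length, by omega⟩ : Fin (l₁.length + l₂.length + 1)),
    σ _ (l₁ ++ l₂), ?_⟩
  refine hσ _ _ _ fun j => congrArg π ?_
  change _ = ((l₁ ++ l₂).take (Fin.predAbove
    (⟨l₁.length, by omega⟩ : Fin (l₁.length + l₂.length + 1)) j)).sum
  by_cases h : (j : ℕ) ≤ l₁.length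
  · rw [Fin.predAbove_of_le_castSucc _ _ (by rw [Fin.le_def]; exact h)]
    change _ = ((l₁ ++ l₂).take (j : ℕ)).sum
    rw [List.take_append_of_le_length h, List.take_append_of_le_length h]
  · rw [Fin.predAbove_of_castSucc_lt _ _ (by rw [Fin.lt_def]; simpa using h), Fin.val_pred]
    obtain ⟨i, hi⟩ : ∃ i, (j : ℕ) = l₁.length + (i + 1) := ⟨j - l₁.length - 1, by omega⟩
    rw [hi, ← add_assoc, Nat.add_sub_cancel, add_assoc, List.take_length_add_append,
      List.take_length_add_append]
    simp

lemma map_sum_eq_zero {π : A →+ A} {l : List A} (h : ∀ a ∈ l, π a = 0) : π l.sum = 0 := by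
  rw [map_list_sum]
  refine List.sum_eq_zero fun x hx => ?_
  obtain ⟨a, ha, rfl⟩ := List.mem_map.1 hx
  exact h a ha

variable {k : Type v} [CommRing k] {P Q : SSet.{u}} {π₁ π₂ : A →+ A}
  {σ : ∀ N : ℕ, List A → P _⦋N⦌} {τ : ∀ N : ℕ, List A → Q _⦋N⦌}

/-- The family `σ` does not see the steps of `l₂`. Along a shuffled word it therefore pauses exactly
at the positions in β, which is the effect of s_β; likewise for `τ` and s_α. -/
lemma shuffleValue_eq_listShuffle (hσ : IsWordFamily P π₁ σ) (hτ : IsWordFamily Q π₂ τ)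
    {p q : ℕ} {l₁ l₂ : List A} (hp : l₁.length = p) (hq : l₂.length = q)
    (h₁ : ∀ a ∈ l₂, π₁ a = 0) (h₂ : ∀ a ∈ l₁, π₂ a = 0) :
    shuffleValue k (σ p l₁) (τ q l₂) =
      listShuffle l₁ l₂ fun w => simplex k (pair (σ (p + q) w) (τ (p + q) w)) := by
  subst hp hq
  rw [← sum_shuffles_eq_listShuffle, shuffleValue]
  refine Finset.sum_congr rfl fun α hα => ?_
  obtain ⟨hc₂, hc₁⟩ := card_shuffleCompl hα
  have hm := sum_take_merge (wordOf (l₁.length + l₂.length) α) l₁ l₂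
    (by rw [count_true_wordOf _ _ _ _ le_rfl, hc₁]) (by rw [count_false_wordOf, hc₂])
  congr 3
  · refine hσ _ _ _ fun j => ?_
    have hj : (j : ℕ) ≤ l₁.length + l₂.length := by omega
    rw [degeneracyHom_apply, hm, take_wordOf _ _ _ hj, map_add, count_true_wordOf _ _ _ _ hj,
      -- The cutoff in `degeneracyHom` is harmless because `take` stops at the end of the list
      -- anyway.
      map_sum_eq_zero fun a ha => h₁ a (List.mem_of_mem_take ha), add_zero, ← List.take_eq_take_min]
  · refine hτ _ _ _ fun j => ?_
    have hj : (j : ℕ) ≤ l₁.length + l₂.length := by omega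
    rw [degeneracyHom_apply, hm, take_wordOf _ _ _ hj, map_add, count_false_wordOf,
      map_sum_eq_zero fun a ha => h₂ a (List.mem_of_mem_take ha), zero_add, ← List.take_eq_take_min]

lemma card_range_sdiff_singleton (j a : ℕ) :
    (Finset.range j \ {a}).card = if j ≤ a then j else j - 1 := by
  split_ifs with h
  · rw [Finset.sdiff_singleton_eq_erase, Finset.erase_eq_of_notMem (by simpa using h),
      Finset.card_range]
  · rw [Finset.sdiff_singleton_eq_erase, Finset.card_erase_of_mem (by simpa using h),
      Finset.card_range]

/-! ### The terms of the homotopy as words -/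

section HomotopyTerm

variable {u s t : List A} {r p q n : ℕ} {α : Finset ℕ}

lemma sum_take_homotopyWord (π : A →+ A) (c : A) (hs : s.length = p + 1) (ht : t.length = q)
    (hu : u.length = r) (hα : α ∈ shuffles (p + 1) q) {i : ℕ} (hi : i ≤ p + 1 + q) :
    π ((u ++ c :: merge (wordOf (p + 1 + q) α) (s.map π₁) (t.map π₂)).take (r + (i + 1))).sum =
      π u.sum + π c + π (π₁ (s.take (Finset.range i \ shuffleCompl (p + 1) q α).card).sum) +
        π (π₂ (t.take (Finset.range i \ α).card).sum) := by
  obtain ⟨hc₂, hc₁⟩ := card_shuffleCompl hα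
  rw [← hu, List.take_length_add_append, List.take_succ_cons, List.sum_append, List.sum_cons,
    sum_take_merge,
    take_wordOf _ _ _ hi, count_true_wordOf _ _ _ _ hi, count_false_wordOf]
  · simp only [map_add, ← List.map_take, ← map_list_sum, add_assoc]
  · rw [count_true_wordOf _ _ _ _ le_rfl, hc₁, List.length_map, hs]
  · rw [count_false_wordOf, hc₂, List.length_map, ht]

/-- With m = `r + 1`, the first component follows `u`, pauses at vertex `r` during the inserted step
(s_{m-1}), then takes the steps of `s` and pauses at those of `t` (s_{β+m}). The last `q` faces
remove the vertices reached only through `t`. -/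
lemma homotopyTerm_left (hσ : IsWordFamily P π₁ σ) (h₁ : ∀ a, π₁ (π₁ a) = π₁ a)
    (h₂ : ∀ a, π₁ (π₂ a) = 0) (hu : u.length = r) (hs : s.length = p + 1) (ht : t.length = q)
    (hn : n = r + (p + 1) + q) (hα : α ∈ shuffles (p + 1) q) :
    degeneracies P ((shuffleCompl (p + 1) q α).image (· + (r + 1))) (n + 1)
        (degeneracies P {r} (n - q + 1) (faces P (n - q + 1) q (n - q) (σ n (u ++ (s ++ t))))) =
      σ (n + 1) (u ++ π₂ s.sum :: merge (wordOf (p + 1 + q) α) (s.map π₁) (t.map π₂)) := by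
  simp only [degeneracies, faces, map_map]
  refine hσ _ _ _ fun j => ?_
  have hv : (((degeneracyHom ((shuffleCompl (p + 1) q α).image (· + (r + 1)))
      (n - q + 1) (n + 1) ≫ degeneracyHom {r} (n - q) (n - q + 1) ≫
      faceHom (n - q + 1) q (n - q) n).toOrderHom j : Fin (n + 1)) : ℕ) =
      min (if min (Finset.range (min (Finset.range j \
        (shuffleCompl (p + 1) q α).image (· + (r + 1))).card (n - q + 1)) \ {r}).card (n - q) <
          n - q + 1 then min (Finset.range (min (Finset.range j \
        (shuffleCompl (p + 1) q α).image (· + (r + 1))).card (n - q + 1)) \ {r}).card (n - q) else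
        min (Finset.range (min (Finset.range j \
        (shuffleCompl (p + 1) q α).image (· + (r + 1))).card (n - q + 1)) \ {r}).card (n - q) + q)
        n := rfl
  rw [card_range_sdiff_singleton] at hv
  rw [hv]
  clear hv
  rcases Nat.lt_or_ge r j with hj | hj
  · obtain ⟨i, hi⟩ : ∃ i, (j : ℕ) = r + (i + 1) := ⟨j - r - 1, by omega⟩
    have hi' : i ≤ p + 1 + q := by omega
    rw [hi, sum_take_homotopyWord _ _ hs ht hu hα hi', h₁, h₂, h₂, add_zero, add_zero,
      show r + (i + 1) = r + 1 + i by ring, card_range_sdiff_shift]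
    have hc : (Finset.range i \ shuffleCompl (p + 1) q α).card ≤ p + 1 :=
      (Finset.card_le_card (Finset.sdiff_subset_sdiff (Finset.range_mono hi') le_rfl)).trans
        (card_shuffleCompl hα).2.le
    set d := (Finset.range i \ shuffleCompl (p + 1) q α).card
    rw [show min _ _ = r + d by split_ifs <;> omega, ← hu, List.take_length_add_append,
      List.sum_append, map_add, List.take_append_of_le_length (by omega)]
  · rw [card_range_sdiff_shift_of_le _ _ _ (by omega),
      show min _ _ = (j : ℕ) by split_ifs <;> omega,
      List.take_append_of_le_length (by omega), List.take_append_of_le_length (by omega)]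

/-- The second component follows `u`, makes all of `s` in the one inserted step, since the faces
omit the interior vertices `r + 1`, …, `r + p`, and then pauses at the steps of `s` while taking
those of `t`. -/
lemma homotopyTerm_right (hτ : IsWordFamily Q π₂ τ) (h₁ : ∀ a, π₂ (π₁ a) = 0)
    (h₂ : ∀ a, π₂ (π₂ a) = π₂ a) (hu : u.length = r) (hs : s.length = p + 1) (ht : t.length = q)
    (hn : n = r + (p + 1) + q) (hα : α ∈ shuffles (p + 1) q) :
    degeneracies Q (α.image (· + (r + 1))) (n + 1)
        (faces Q (r + 1) p (n - p) (τ n (u ++ (s ++ t)))) =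
      τ (n + 1) (u ++ π₂ s.sum :: merge (wordOf (p + 1 + q) α) (s.map π₁) (t.map π₂)) := by
  simp only [degeneracies, faces, map_map]
  refine hτ _ _ _ fun j => ?_
  have hv : (((degeneracyHom (α.image (· + (r + 1))) (n - p) (n + 1) ≫
      faceHom (r + 1) p (n - p) n).toOrderHom j : Fin (n + 1)) : ℕ) =
      min (if min (Finset.range j \ α.image (· + (r + 1))).card (n - p) < r + 1 then
        min (Finset.range j \ α.image (· + (r + 1))).card (n - p) else
        min (Finset.range j \ α.image (· + (r + 1))).card (n - p) + p) n := rfl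
  rw [hv]
  clear hv
  rcases Nat.lt_or_ge r j with hj | hj
  · obtain ⟨i, hi⟩ : ∃ i, (j : ℕ) = r + (i + 1) := ⟨j - r - 1, by omega⟩
    have hi' : i ≤ p + 1 + q := by omega
    rw [hi, sum_take_homotopyWord _ _ hs ht hu hα hi', h₁, h₂, h₂, add_zero,
      show r + (i + 1) = r + 1 + i by ring, card_range_sdiff_shift]
    have hc : (Finset.range i \ α).card ≤ q :=
      (Finset.card_le_card (Finset.sdiff_subset_sdiff (Finset.range_mono hi') le_rfl)).trans
        (card_shuffleCompl hα).1.le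
    set d := (Finset.range i \ α).card
    rw [show min _ _ = r + (p + 1 + d) by split_ifs <;> omega, ← hu, List.take_length_add_append,
      ← hs, List.take_length_add_append, List.sum_append, List.sum_append, map_add, map_add,
      add_assoc]
  · rw [card_range_sdiff_shift_of_le _ _ _ (by omega),
      show min _ _ = (j : ℕ) by split_ifs <;> omega,
      List.take_append_of_le_length (by omega), List.take_append_of_le_length (by omega)]

end HomotopyTerm

/-- Passes from the indices p, q of the defining formula to the length i = n - p - 1 - q of `u` and
p. -/
lemma sum_range_triangle {M : Type*} [AddCommMonoid M] (n : ℕ) (g : ℕ → ℕ → M) :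
    ∑ p ∈ Finset.range n, ∑ q ∈ Finset.range (n - p), g (n - p - 1 - q) p =
      ∑ i ∈ Finset.range n, ∑ p ∈ Finset.range (n - i), g i p := by
  symm
  rw [Finset.sum_comm' (t' := Finset.range n) (s' := fun p => Finset.range (n - p))]
  · exact Finset.sum_congr rfl fun p _ =>
      (Finset.sum_range_reflect (fun i => g i p) (n - p)).symm
  · intro i p
    simp only [Finset.mem_range]
    omega

lemma homotopyValue_eq_listHomotopy (hσ : IsWordFamily P π₁ σ) (hτ : IsWordFamily Q π₂ τ)
    (h₁₁ : ∀ a, π₁ (π₁ a) = π₁ a) (h₁₂ : ∀ a, π₁ (π₂ a) = 0) (h₂₁ : ∀ a, π₂ (π₁ a) = 0)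
    (h₂₂ : ∀ a, π₂ (π₂ a) = π₂ a)
    (h0 : ∀ n w, w.length = n → 0 ∈ w → simplex k (pair (σ n w) (τ n w)) = 0)
    {n : ℕ} {l : List A} (hn : l.length = n) :
    homotopyValue k (σ n l) (τ n l) = listHomotopy π₁ π₂
      (fun w => simplex k (pair (σ (n + 1) w) (τ (n + 1) w))) l := by
  subst hn
  set n := l.length with hn
  have hR : listHomotopy π₁ π₂ (fun w => simplex k (pair (σ (n + 1) w) (τ (n + 1) w))) l =
      ∑ i ∈ Finset.range n, ∑ p ∈ Finset.range (n - i), (-1 : ℤ) ^ i •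
        listShuffle (((l.drop i).take (p + 1)).map π₁) (((l.drop i).drop (p + 1)).map π₂)
          fun w => simplex k (pair
            (σ (n + 1) (l.take i ++ π₂ ((l.drop i).take (p + 1)).sum :: w))
            (τ (n + 1) (l.take i ++ π₂ ((l.drop i).take (p + 1)).sum :: w))) := by
    -- The cuts with `s` empty, including those where `u` is the whole word, have no counterpart in
    -- the formula. They insert the step π₂(0) = 0 and vanish by `h0`, which leaves `s` of length `p
    -- + 1`.
    rw [listHomotopy, cut_eq_sum, Finset.sum_range_succ, List.drop_length, cut_nil,
      List.map_nil, listShuffle_nil_left, h0, smul_zero, add_zero]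
    · refine Finset.sum_congr rfl fun i hi => ?_
      have hi' := Finset.mem_range.1 hi
      rw [cut_eq_sum, Finset.sum_range_succ', List.length_drop, List.take_zero, List.drop_zero,
        List.map_nil, listShuffle_nil_left, h0, smul_zero, add_zero]
      · rw [List.length_take, min_eq_left hi'.le]
      · simp; omega
      · simp
    · simp [hn]
    · simp
  rw [hR, ← sum_range_triangle, homotopyValue]
  refine Finset.sum_congr rfl fun p hp => Finset.sum_congr rfl fun q hq => ?_
  rw [Finset.mem_range] at hp hq
  obtain ⟨r, hr⟩ : ∃ r, r = n - p - 1 - q := ⟨_, rfl⟩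
  have hs : ((l.drop r).take (p + 1)).length = p + 1 := by simp; omega
  have ht : ((l.drop r).drop (p + 1)).length = q := by simp; omega
  have hu : (l.take r).length = r := by simp; omega
  have hl : l = l.take r ++ ((l.drop r).take (p + 1) ++ (l.drop r).drop (p + 1)) := by simp
  rw [← hr, show n - p - q = r + 1 by omega, ← sum_shuffles_eq_listShuffle, Finset.smul_sum,
    List.length_map, List.length_map, hs, ht]
  refine Finset.sum_congr rfl fun α hα => ?_
  have e₁ := homotopyTerm_left hσ h₁₁ h₁₂ hu hs ht (n := n) (by omega) hα
  have e₂ := homotopyTerm_right hτ h₂₁ h₂₂ hu hs ht (n := n) (by omega) hα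
  rw [← hl] at e₁ e₂
  simp only [Nat.add_sub_cancel]
  rw [e₁, e₂, smul_smul, show (-1 : ℤ) ^ (r + 1 + 1) = (-1) ^ r by ring]

end Families

/-! ### Compatibility of the homotopy with the shuffle map -/

section Compatibility

/-- Every simplex is thus a value of a word family, on a constant word of unit steps. -/
lemma map_pathHom_replicate {A : Type*} [AddCommMonoid A] {X : SSet.{u}} {n : ℕ} (x : X _⦋n⦌)
    (c : A →+ ℕ) (a : A) (ha : c a = 1) :
    X.map (pathHom c (List.replicate n a) n n).op x = x := by
  have h : pathHom c (List.replicate n a) n n = 𝟙 _ := by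
    apply hom_ext_val
    intro j
    have hj : (j : ℕ) ≤ n := by have := j.2; exact Nat.lt_succ_iff.1 this
    rw [pathHom_apply, List.take_replicate, List.sum_replicate, map_nsmul, ha]
    simp [hj]
  rw [h, op_id, X.map_id]
  rfl

/-- The steps of a simplex of a product of three simplicial sets. -/
abbrev Step : Type := ℕ × ℕ × ℕ

/-- The projection of steps to a subset of the factors; the entries of `e` are `0` and `1`. -/
abbrev stepProj (e : Step) : Step →+ Step := AddMonoidHom.mulLeft e

lemma stepProj_comp (e f a : Step) : stepProj e (stepProj f a) = stepProj (e * f) a :=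
  (mul_assoc e f a).symm

lemma stepProj_comp_self {e : Step} (h : e * e = e) (a : Step) :
    stepProj e (stepProj e a) = stepProj e a := by rw [stepProj_comp, h]

lemma stepProj_comp_of_mul_eq_zero {e f : Step} (h : e * f = 0) (a : Step) :
    stepProj e (stepProj f a) = 0 := by rw [stepProj_comp, h]; exact zero_mul a

lemma IsWordFamily.mono_of_mul {P : SSet.{u}} {e f : Step} {σ : ∀ N : ℕ, List Step → P _⦋N⦌}
    (hσ : IsWordFamily P (stepProj e) σ) (h : e * f = e) : IsWordFamily P (stepProj f) σ :=
  hσ.mono fun a => by rw [stepProj_comp, h]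

/-- Coordinate projections commute, so each preserves the kernel of any other. -/
lemma stepProj_mem_mker (e f a : Step) (ha : a ∈ AddMonoidHom.mker (stepProj f)) :
    stepProj e a ∈ AddMonoidHom.mker (stepProj f) := by
  rw [AddMonoidHom.mem_mker] at ha ⊢
  rw [stepProj_comp, mul_comm, ← stepProj_comp, ha, map_zero]

/-- The first coordinate of a step. -/
abbrev stepCoord₁ : Step →+ ℕ := AddMonoidHom.fst ℕ (ℕ × ℕ)

/-- The second coordinate of a step. -/
abbrev stepCoord₂ : Step →+ ℕ := (AddMonoidHom.fst ℕ ℕ).comp (AddMonoidHom.snd ℕ (ℕ × ℕ))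

/-- The third coordinate of a step. -/
abbrev stepCoord₃ : Step →+ ℕ := (AddMonoidHom.snd ℕ ℕ).comp (AddMonoidHom.snd ℕ (ℕ × ℕ))

variable {k : Type v} [CommRing k] {X Y Z : SSet.{u}}

lemma mapChains_associator_inv {n : ℕ} (x : X _⦋n⦌) (y : Y _⦋n⦌) (z : Z _⦋n⦌) :
    mapChains k (α_ X Y Z).inv (simplex k (pair x (pair y z))) = simplex k (pair (pair x y) z) :=
  mapChains_simplex k _ _

lemma mapChains_associator_hom {n : ℕ} (x : X _⦋n⦌) (y : Y _⦋n⦌) (z : Z _⦋n⦌) :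
    mapChains k (α_ X Y Z).hom (simplex k (pair (pair x y) z)) = simplex k (pair x (pair y z)) :=
  mapChains_simplex k _ _

lemma homotopy_shuffle_simplex_left {a b : ℕ} (x : X _⦋a⦌) (y : Y _⦋b⦌) (z : Z _⦋b⦌) :
    homotopy k (X ⊗ Y) Z (mapChains k (α_ X Y Z).inv
        (shuffle k X (Y ⊗ Z) (simplex k x ⊗ₜ simplex k (pair y z)))) =
      (-1 : ℤ) ^ a • mapChains k (α_ X Y Z).inv
        (shuffle k X (Y ⊗ Z) (simplex k x ⊗ₜ homotopy k Y Z (simplex k (pair y z)))) := by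
  obtain ⟨l₁, hl₁⟩ : ∃ l : List Step, l = List.replicate a (1, 0, 0) := ⟨_, rfl⟩
  obtain ⟨l₂, hl₂⟩ : ∃ l : List Step, l = List.replicate b (0, 1, 1) := ⟨_, rfl⟩
  have hla : l₁.length = a := by simp [hl₁]
  have hlb : l₂.length = b := by simp [hl₂]
  -- The families are kept abstract: only their value on the initial word and the family property
  -- are used.
  obtain ⟨σ, hσx, hσ⟩ : ∃ σ : ∀ N, List Step → X _⦋N⦌, σ a l₁ = x ∧
      IsWordFamily X (stepProj (1, 0, 0)) σ :=
    ⟨_, by rw [hl₁]; exact map_pathHom_replicate x stepCoord₁ _ rfl,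
      isWordFamily_path x stepCoord₁ _ fun a => by simp⟩
  obtain ⟨τ, hτy, hτ⟩ : ∃ τ : ∀ N, List Step → Y _⦋N⦌, τ b l₂ = y ∧
      IsWordFamily Y (stepProj (0, 1, 0)) τ :=
    ⟨_, by rw [hl₂]; exact map_pathHom_replicate y stepCoord₂ _ rfl,
      isWordFamily_path y stepCoord₂ _ fun a => by simp⟩
  obtain ⟨ρ, hρz, hρ⟩ : ∃ ρ : ∀ N, List Step → Z _⦋N⦌, ρ b l₂ = z ∧
      IsWordFamily Z (stepProj (0, 0, 1)) ρ :=
    ⟨_, by rw [hl₂]; exact map_pathHom_replicate z stepCoord₃ _ rfl,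
      isWordFamily_path z stepCoord₃ _ fun a => by simp⟩
  have hστ : IsWordFamily (X ⊗ Y : SSet.{u}) (stepProj (1, 1, 0)) fun N l => pair (σ N l) (τ N l) :=
    (hσ.mono_of_mul rfl).pair (hτ.mono_of_mul rfl)
  have hτρ : IsWordFamily (Y ⊗ Z : SSet.{u}) (stepProj (0, 1, 1)) fun N l => pair (τ N l) (ρ N l) :=
    (hτ.mono_of_mul rfl).pair (hρ.mono_of_mul rfl)
  have hστρ : IsWordFamily ((X ⊗ Y) ⊗ Z : SSet.{u}) (stepProj (1, 1, 1))
      fun N l => pair (pair (σ N l) (τ N l)) (ρ N l) :=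
    (hστ.mono_of_mul rfl).pair (hρ.mono_of_mul rfl)
  have h₁ : ∀ a ∈ l₁, a = (1, 0, 0) := fun a ha => List.eq_of_mem_replicate (hl₁ ▸ ha)
  have h₂ : ∀ a ∈ l₂, a = (0, 1, 1) := fun a ha => List.eq_of_mem_replicate (hl₂ ▸ ha)
  have hL : homotopy k (X ⊗ Y) Z (mapChains k (α_ X Y Z).inv
        (shuffle k X (Y ⊗ Z) (simplex k x ⊗ₜ simplex k (pair y z)))) =
      listShuffle l₁ l₂ (listHomotopy (stepProj (1, 1, 0)) (stepProj (0, 0, 1)) fun w =>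
        simplex k (pair (pair (σ (a + b + 1) w) (τ (a + b + 1) w)) (ρ (a + b + 1) w))) := by
    rw [shuffle_simplex, ← hσx, ← hτy, ← hρz, shuffleValue_eq_listShuffle hσ hτρ hla hlb]
    · refine (map_listShuffle (homotopy k (X ⊗ Y) Z ∘ₗ mapChains k (α_ X Y Z).inv).toAddMonoidHom
        l₁ l₂ _).trans (listShuffle_congr fun w hw => ?_)
      change homotopy k (X ⊗ Y) Z (mapChains k (α_ X Y Z).inv (simplex k _)) = _
      rw [mapChains_associator_inv, homotopy_simplex, homotopyValue_eq_listHomotopy hστ hρ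
        (stepProj_comp_self rfl) (stepProj_comp_of_mul_eq_zero rfl) (stepProj_comp_of_mul_eq_zero rfl)
        (stepProj_comp_self rfl)]
      · exact fun n w hw h0 => simplex_eq_zero k _ (hστρ.degenerate hw h0)
      · rw [hw.length_eq, List.length_append, hla, hlb]
    · intro a ha; rw [h₂ a ha]; rfl
    · intro a ha; rw [h₁ a ha]; rfl
  rw [hL, listHomotopy_shuffle_left, hla, homotopy_simplex, ← hτy, ← hρz,
    -- The homotopy for `Y`, `Z` is written with the projections that belong to `(X ⊗ Y) ⊗ Z`. The
    -- additional first coordinate is invisible to `τ`, and both sides now involve the same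
    -- operation on words.
    homotopyValue_eq_listHomotopy (π₁ := stepProj (1, 1, 0)) (π₂ := stepProj (0, 0, 1))
      (hτ.mono_of_mul rfl) hρ (stepProj_comp_self rfl) (stepProj_comp_of_mul_eq_zero rfl)
      (stepProj_comp_of_mul_eq_zero rfl) (stepProj_comp_self rfl)
      (fun n w hw h0 => simplex_eq_zero k _ (hτρ.degenerate hw h0)) hlb]
  · congr 1
    refine ((map_listHomotopy (mapChains k (α_ X Y Z).inv ∘ₗ shuffle k X (Y ⊗ Z) ∘ₗ
      TensorProduct.mk k _ _ (simplex k x)).toAddMonoidHom _ _ _ _).trans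
      -- All words produced from `l₂` have first coordinate zero, as needed to shuffle them with
      -- `l₁`.
      (listHomotopy_congr (AddMonoidHom.mker (stepProj (1, 0, 0))) ?_ ?_ ?_ ?_)).symm
    · exact fun a ha => stepProj_mem_mker _ _ a ha
    · exact fun a ha => stepProj_mem_mker _ _ a ha
    · intro a ha; rw [h₂ a ha]; rfl
    · intro w hw hS
      change mapChains k (α_ X Y Z).inv (shuffle k X (Y ⊗ Z) (simplex k x ⊗ₜ simplex k _)) = _
      rw [shuffle_simplex, ← hσx,
        shuffleValue_eq_listShuffle hσ hτρ hla (hw.trans (by rw [hlb])) hS]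
      · refine (map_listShuffle (mapChains k (α_ X Y Z).inv).toAddMonoidHom _ _ _).trans
          (listShuffle_congr fun w' _ => ?_)
        exact mapChains_associator_inv _ _ _
      · intro a ha; rw [h₁ a ha]; rfl
  · intro w hw h0
    exact simplex_eq_zero k _ (hστρ.degenerate (by rw [hw, hla, hlb]) h0)
  · intro a ha; rw [h₁ a ha]; rfl
  · intro a ha; rw [h₁ a ha]; rfl

lemma homotopy_shuffle_simplex_right {a b : ℕ} (x : X _⦋a⦌) (y : Y _⦋a⦌) (z : Z _⦋b⦌) :
    homotopy k X (Y ⊗ Z) (mapChains k (α_ X Y Z).hom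
        (shuffle k (X ⊗ Y) Z (simplex k (pair x y) ⊗ₜ simplex k z))) =
      mapChains k (α_ X Y Z).hom
        (shuffle k (X ⊗ Y) Z (homotopy k X Y (simplex k (pair x y)) ⊗ₜ simplex k z)) := by
  obtain ⟨l₁, hl₁⟩ : ∃ l : List Step, l = List.replicate a (1, 1, 0) := ⟨_, rfl⟩
  obtain ⟨l₂, hl₂⟩ : ∃ l : List Step, l = List.replicate b (0, 0, 1) := ⟨_, rfl⟩
  have hla : l₁.length = a := by simp [hl₁]
  have hlb : l₂.length = b := by simp [hl₂]
  obtain ⟨σ, hσx, hσ⟩ : ∃ σ : ∀ N, List Step → X _⦋N⦌, σ a l₁ = x ∧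
      IsWordFamily X (stepProj (1, 0, 0)) σ :=
    ⟨_, by rw [hl₁]; exact map_pathHom_replicate x stepCoord₁ _ rfl,
      isWordFamily_path x stepCoord₁ _ fun a => by simp⟩
  obtain ⟨τ, hτy, hτ⟩ : ∃ τ : ∀ N, List Step → Y _⦋N⦌, τ a l₁ = y ∧
      IsWordFamily Y (stepProj (0, 1, 0)) τ :=
    ⟨_, by rw [hl₁]; exact map_pathHom_replicate y stepCoord₂ _ rfl,
      isWordFamily_path y stepCoord₂ _ fun a => by simp⟩
  obtain ⟨ρ, hρz, hρ⟩ : ∃ ρ : ∀ N, List Step → Z _⦋N⦌, ρ b l₂ = z ∧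
      IsWordFamily Z (stepProj (0, 0, 1)) ρ :=
    ⟨_, by rw [hl₂]; exact map_pathHom_replicate z stepCoord₃ _ rfl,
      isWordFamily_path z stepCoord₃ _ fun a => by simp⟩
  have hστ : IsWordFamily (X ⊗ Y : SSet.{u}) (stepProj (1, 1, 0)) fun N l => pair (σ N l) (τ N l) :=
    (hσ.mono_of_mul rfl).pair (hτ.mono_of_mul rfl)
  have hτρ : IsWordFamily (Y ⊗ Z : SSet.{u}) (stepProj (0, 1, 1)) fun N l => pair (τ N l) (ρ N l) :=
    (hτ.mono_of_mul rfl).pair (hρ.mono_of_mul rfl)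
  have hστρ : IsWordFamily (X ⊗ (Y ⊗ Z) : SSet.{u}) (stepProj (1, 1, 1))
      fun N l => pair (σ N l) (pair (τ N l) (ρ N l)) :=
    (hσ.mono_of_mul rfl).pair (hτρ.mono_of_mul rfl)
  have h₁ : ∀ a ∈ l₁, a = (1, 1, 0) := fun a ha => List.eq_of_mem_replicate (hl₁ ▸ ha)
  have h₂ : ∀ a ∈ l₂, a = (0, 0, 1) := fun a ha => List.eq_of_mem_replicate (hl₂ ▸ ha)
  have hL : homotopy k X (Y ⊗ Z) (mapChains k (α_ X Y Z).hom
        (shuffle k (X ⊗ Y) Z (simplex k (pair x y) ⊗ₜ simplex k z))) =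
      listShuffle l₁ l₂ (listHomotopy (stepProj (1, 0, 0)) (stepProj (0, 1, 1)) fun w =>
        simplex k (pair (σ (a + b + 1) w) (pair (τ (a + b + 1) w) (ρ (a + b + 1) w)))) := by
    rw [shuffle_simplex, ← hσx, ← hτy, ← hρz, shuffleValue_eq_listShuffle hστ hρ hla hlb]
    · refine (map_listShuffle (homotopy k X (Y ⊗ Z) ∘ₗ mapChains k (α_ X Y Z).hom).toAddMonoidHom
        l₁ l₂ _).trans (listShuffle_congr fun w hw => ?_)
      change homotopy k X (Y ⊗ Z) (mapChains k (α_ X Y Z).hom (simplex k _)) = _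
      rw [mapChains_associator_hom, homotopy_simplex, homotopyValue_eq_listHomotopy hσ hτρ
        (stepProj_comp_self rfl) (stepProj_comp_of_mul_eq_zero rfl)
        (stepProj_comp_of_mul_eq_zero rfl) (stepProj_comp_self rfl)]
      · exact fun n w hw h0 => simplex_eq_zero k _ (hστρ.degenerate hw h0)
      · rw [hw.length_eq, List.length_append, hla, hlb]
    · intro a ha; rw [h₂ a ha]; rfl
    · intro a ha; rw [h₁ a ha]; rfl
  rw [hL, listHomotopy_shuffle_right, homotopy_simplex, ← hσx, ← hτy,
    -- Here the projection for `Y` is enlarged by the third coordinate, to match `X ⊗ (Y ⊗ Z)`.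
    homotopyValue_eq_listHomotopy (π₁ := stepProj (1, 0, 0)) (π₂ := stepProj (0, 1, 1))
      hσ (hτ.mono_of_mul rfl) (stepProj_comp_self rfl) (stepProj_comp_of_mul_eq_zero rfl)
      (stepProj_comp_of_mul_eq_zero rfl) (stepProj_comp_self rfl)
      (fun n w hw h0 => simplex_eq_zero k _ (hστ.degenerate hw h0)) hla]
  · refine ((map_listHomotopy (mapChains k (α_ X Y Z).hom ∘ₗ shuffle k (X ⊗ Y) Z ∘ₗ
      (TensorProduct.mk k _ _).flip (simplex k z)).toAddMonoidHom _ _ _ _).trans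
      (listHomotopy_congr (AddMonoidHom.mker (stepProj (0, 0, 1))) ?_ ?_ ?_ ?_)).symm
    · exact fun a ha => stepProj_mem_mker _ _ a ha
    · exact fun a ha => stepProj_mem_mker _ _ a ha
    · intro a ha; rw [h₁ a ha]; rfl
    · intro w hw hS
      change mapChains k (α_ X Y Z).hom (shuffle k (X ⊗ Y) Z (simplex k _ ⊗ₜ simplex k z)) = _
      rw [shuffle_simplex, ← hρz,
        shuffleValue_eq_listShuffle hστ hρ (hw.trans (by rw [hla])) hlb _ hS]
      · refine (map_listShuffle (mapChains k (α_ X Y Z).hom).toAddMonoidHom _ _ _).trans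
          (listShuffle_congr fun w' _ => ?_)
        rw [show a + b + 1 = a + 1 + b by ring]
        exact mapChains_associator_hom _ _ _
      · intro a ha; rw [h₂ a ha]; rfl
  · intro w hw h0
    exact simplex_eq_zero k _ (hστρ.degenerate (by rw [hw, hla, hlb]) h0)
  · intro a ha; rw [h₂ a ha]; rfl
  · intro a ha; rw [h₂ a ha]; rfl

end Compatibility

end EilenbergZilber

end

/-! ### From simplices to tensor products of chains -/

theorem mainTheorem4 (k : Type v) [CommRing k] (X Y Z : SSet.{u}) :
    (EilenbergZilber.homotopy k (X ⊗ Y) Z ∘ₗ EilenbergZilber.mapChains k (α_ X Y Z).inv ∘ₗ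
        EilenbergZilber.shuffle k X (Y ⊗ Z) =
      EilenbergZilber.mapChains k (α_ X Y Z).inv ∘ₗ EilenbergZilber.shuffle k X (Y ⊗ Z) ∘ₗ
        EilenbergZilber.koszulTensor 1 LinearMap.id (EilenbergZilber.homotopy k Y Z)) ∧
    (EilenbergZilber.homotopy k X (Y ⊗ Z) ∘ₗ EilenbergZilber.mapChains k (α_ X Y Z).hom ∘ₗ
        EilenbergZilber.shuffle k (X ⊗ Y) Z =
      EilenbergZilber.mapChains k (α_ X Y Z).hom ∘ₗ EilenbergZilber.shuffle k (X ⊗ Y) Z ∘ₗ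
        EilenbergZilber.koszulTensor 0 (EilenbergZilber.homotopy k X Y) LinearMap.id) := by
  constructor
  · refine TensorProduct.ext (EilenbergZilber.chains_hom_ext fun a x =>
      EilenbergZilber.chains_hom_ext fun b w => ?_)
    refine (EilenbergZilber.homotopy_shuffle_simplex_left x w.1 w.2).trans ?_
    change _ = EilenbergZilber.mapChains k (α_ X Y Z).inv (EilenbergZilber.shuffle k X (Y ⊗ Z)
      (EilenbergZilber.koszulTensor 1 LinearMap.id (EilenbergZilber.homotopy k Y Z)
        (EilenbergZilber.simplex k x ⊗ₜ EilenbergZilber.simplex k w)))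
    -- The word calculus yields an integer sign, the Koszul rule one in `k`; the two actions are
    -- identified.
    rw [EilenbergZilber.koszulTensor_simplex, one_mul, map_smul, map_smul, LinearMap.id_apply,
      ← Int.cast_smul_eq_zsmul k]
    push_cast
    rfl
  · refine TensorProduct.ext (EilenbergZilber.chains_hom_ext fun a w =>
      EilenbergZilber.chains_hom_ext fun b z => ?_)
    refine (EilenbergZilber.homotopy_shuffle_simplex_right w.1 w.2 z).trans ?_
    change _ = EilenbergZilber.mapChains k (α_ X Y Z).hom (EilenbergZilber.shuffle k (X ⊗ Y) Z
      (EilenbergZilber.koszulTensor 0 (EilenbergZilber.homotopy k X Y) LinearMap.id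
        (EilenbergZilber.simplex k w ⊗ₜ EilenbergZilber.simplex k z)))
    rw [EilenbergZilber.koszulTensor_simplex, zero_mul, pow_zero, one_smul, LinearMap.id_apply]
    rfl
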